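/- Let $K \ge 1$ be an integer and $\rho > 0$. Consider the join-the-shortest-queue (JSQ) system: two single-server queues, each with capacity $K$ (customer in service included); customers arrive in a Poisson flow of rate $2\rho$ and join the shorter queue, or either of the two with probability $1/2$ when the lengths are equal; a customer who finds both queues full is lost; each server works at rate $1$ (exponential service times). Let $(L_1(t),L_2(t))$ be the Markov process of the queue lengths, on $\{0,\dots,K\}^2$, and $N(t)=L_1(t)+L_2(t)$ the total number of customers. Let $\overline N$, $\underline N$ and $\underline{\underline N}$ be the Markov processes of the numbers of customers in, respectively, an $M/M/1/K$ queue with arrival rate $2\rho$ and service rate $2$, an $M/M/2/2K$ queue with arrival rate $2\rho$ and service rate $1$ per server, and an $M/M/1/2K$ queue with arrival rate $2\rho$ and service rate $2$ (in $M/M/c/m$, $c$ is the number of servers and $m$ the maximal number of customers in the system). (i) For every joint law of the initial values $\big(\underline{\underline N}(0),\underline N(0),(L_1(0),L_2(0)),\overline N(0)\big)$, the four processes $\underline{\underline N}$, $\underline N$, $(L_1,L_2)$ and $\overline N$ can be constructed on one probability space, with this joint initial law and with right-continuous paths with left limits, in such a way that almost surely, if the inequalities $$\underline{\underline N}(t)\le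 \underline N(t)\le N(t)\le K+\overline N(t)$$ hold at $t=0$, then they hold at all times $t\ge 0$. (ii) Each of the four Markov processes has a unique invariant probability distribution. Writing $\pi_K$ for that of $(L_1,L_2)$, and $\nu_K$, $\nu'$, $\nu_{2K}$ for those of the $M/M/1/K$, $M/M/2/2K$ and $M/M/1/2K$ queues above, the stationary blocking probabilities (the stationary probabilities that the system is full) satisfy $$\nu_{2K}(2K)\le \nu'(2K)\le \pi_K(K,K)\le \nu_K(K).$$ -/

import Mathlib

open scoped NNReal

/-- Infinitesimal generator of the Markov jump process on a finite set which jumps from `x` to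
`y ≠ x` at rate `q x y`: off the diagonal it is `q`, and every row sums to zero
(the value `q x x` is irrelevant). -/
def jumpGenerator {S : Type*} [Fintype S] [DecidableEq S] (q : S → S → ℝ) : Matrix S S ℝ :=
  Matrix.of q - Matrix.diagonal (fun x => ∑ z, q x z)

/-- The transition matrix over a time interval of length `t`, that is `exp (t Q)`. -/
noncomputable def transitionMatrix {S : Type*} [Fintype S] [DecidableEq S]
    (Q : Matrix S S ℝ) (t : ℝ) : Matrix S S ℝ :=
  NormedSpace.exp (t • Q)

/-- `X` is, under `P`, a time-homogeneous Markov jump process with generator `Q` on the finite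
set `S`: its paths are right-continuous with left limits (for the discrete topology of `S`), and
its finite-dimensional distributions are those of a Markov process with transition matrices
`exp (t Q)`. -/
structure IsMarkovJumpProcess {S : Type*} [Fintype S] [DecidableEq S] (Q : Matrix S S ℝ)
    {Ω : Type*} [MeasurableSpace Ω] (P : MeasureTheory.Measure Ω) (X : ℝ≥0 → Ω → S) : Prop where
  measurableSet_eq : ∀ (t : ℝ≥0) (x : S), MeasurableSet {ω | X t ω = x}
  right_continuous : ∀ (ω : Ω) (t : ℝ≥0), ∀ᶠ s in nhdsWithin t (Set.Ioi t), X s ω = X t ω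
  left_limits : ∀ (ω : Ω) (t : ℝ≥0), ∃ l : S, ∀ᶠ s in nhdsWithin t (Set.Iio t), X s ω = l
  finite_dim : ∀ (n : ℕ) (t : ℕ → ℝ≥0) (x : ℕ → S), Monotone t →
    P.real {ω | ∀ i ≤ n, X (t i) ω = x i} =
      P.real {ω | X (t 0) ω = x 0} *
        ∏ i ∈ Finset.range n,
          transitionMatrix Q ((t (i + 1) : ℝ) - (t i : ℝ)) (x i) (x (i + 1))

/-- `π` is an invariant probability distribution of the Markov process with generator `Q`. -/
structure IsInvariantDistribution {S : Type*} [Fintype S] [DecidableEq S] (Q : Matrix S S ℝ)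
    (π : S → ℝ) : Prop where
  nonneg : ∀ x, 0 ≤ π x
  sum_eq_one : ∑ x, π x = 1
  invariant : ∀ t : ℝ, 0 ≤ t → Matrix.vecMul π (transitionMatrix Q t) = π

/-- `π` is the unique invariant probability distribution of the process with generator `Q`. -/
def IsUniqueInvariantDistribution {S : Type*} [Fintype S] [DecidableEq S] (Q : Matrix S S ℝ)
    (π : S → ℝ) : Prop :=
  IsInvariantDistribution Q π ∧ ∀ π' : S → ℝ, IsInvariantDistribution Q π' → π' = π

/-- States `(L₁, L₂)` of two queues, each with capacity `K`. -/
abbrev JSQState (K : ℕ) : Type := Fin (K + 1) × Fin (K + 1)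

/-- Rate at which customers join a queue of length `a` when the other queue has length `b` and
the total arrival rate is `2ρ`: all of them if `a < b`, half of them if `a = b`, none if `a > b`. -/
def joinRate (ρ : ℝ) (a b : ℕ) : ℝ :=
  if a < b then 2 * ρ else if a = b then ρ else 0

/-- Jump rates of the join-the-shortest-queue process `(L₁, L₂)`: arrivals at rate `2ρ`, each of
the two servers works at rate 1. An arrival in state `(K, K)` is lost, since there is no state with
`K + 1` customers in a queue. -/
def jsqRate (K : ℕ) (ρ : ℝ) (x y : JSQState K) : ℝ :=
  if (y.1 : ℕ) = x.1 + 1 ∧ y.2 = x.2 then joinRate ρ x.1 x.2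
  else if y.1 = x.1 ∧ (y.2 : ℕ) = x.2 + 1 then joinRate ρ x.2 x.1
  else if (x.1 : ℕ) = y.1 + 1 ∧ y.2 = x.2 then 1
  else if y.1 = x.1 ∧ (x.2 : ℕ) = y.2 + 1 then 1
  else 0

/-- Generator of the join-the-shortest-queue process `(L₁, L₂)`. -/
def jsqGenerator (K : ℕ) (ρ : ℝ) : Matrix (JSQState K) (JSQState K) ℝ :=
  jumpGenerator (jsqRate K ρ)

/-- Jump rates of the number of customers in an `M/M/c/m` queue (`c` servers, at most `m` customers
in the system) with arrival rate `a` and service rate `s` per server. -/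
def mmcRate (c m : ℕ) (a s : ℝ) (x y : Fin (m + 1)) : ℝ :=
  if (y : ℕ) = x + 1 then a
  else if (x : ℕ) = y + 1 then s * (min (x : ℕ) c : ℕ)
  else 0

/-- Generator of the number of customers in an `M/M/c/m` queue. -/
def mmcGenerator (c m : ℕ) (a s : ℝ) : Matrix (Fin (m + 1)) (Fin (m + 1)) ℝ :=
  jumpGenerator (mmcRate c m a s)

/-- The inequalities `n₁ ≤ n₂ ≤ l₁ + l₂ ≤ K + n₃` between the numbers of customers in the
`M/M/1/2K` queue, the `M/M/2/2K` queue, the join-the-shortest-queue system and the `M/M/1/K`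
queue. -/
def QueueOrder (K : ℕ) (n₁ n₂ : Fin (2 * K + 1)) (l : JSQState K) (n₃ : Fin (K + 1)) : Prop :=
  (n₁ : ℕ) ≤ n₂ ∧ (n₂ : ℕ) ≤ l.1 + l.2 ∧ (l.1 : ℕ) + l.2 ≤ K + n₃

/-! All four systems are driven by the same events: arrivals at total rate `2 * ρ`, each carrying a
fair coin, and services at rate 1 at each of two servers. An `M/M/1` queue uses every service. The
`M/M/2` queue uses every service when it holds at least two customers. With a single customer it
listens to one server only, chosen to be a busy server of the JSQ system if there is one. No event
breaks the order (`coupledStep_queueOrder`). Two facts about JSQ matter: a customer is lost only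
when both queues are full, and a service is wasted only when one queue is empty, so that the total
is then at most `K`.

The coupled chain is built by uniformization: i.i.d. exponential gaps whose rate is the sum of the
event rates, and i.i.d. marks. Each coordinate `g` of the chain is lumpable, since its jump rates
depend on its own value alone. Hence it is Markov with the required generator
(`isMarkovJumpProcess_of_rates`). Conditioning on the first gap gives Poisson weights for the number
of jumps, and these sum to the matrix exponential.

For the blocking probabilities, take stationary weights of the coupled chain restricted to ordered
states. Their marginals are the four invariant laws, unique because the empty state can be reached
from everywhere. In an ordered state, fullness passes up the chain of inequalities from each system
to the next. -/

open MeasureTheory ProbabilityTheory Set Filter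

/-! ### Splitting off the first term of an i.i.d. sequence -/

/-- The sequence with head `a` and tail `ω`. -/
def seqCons {α : Type*} (a : α) (ω : ℕ → α) : ℕ → α
  | 0 => a
  | n + 1 => ω n

@[simp] theorem seqCons_zero {α : Type*} (a : α) (ω : ℕ → α) : seqCons a ω 0 = a := rfl

@[simp] theorem seqCons_succ {α : Type*} (a : α) (ω : ℕ → α) (n : ℕ) :
    seqCons a ω (n + 1) = ω n := rfl

theorem measurable_seqCons {α : Type*} [MeasurableSpace α] :
    Measurable (fun p : α × (ℕ → α) => seqCons p.1 p.2) := by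
  refine measurable_pi_iff.2 fun n => ?_
  cases n with
  | zero => exact measurable_fst
  | succ n => exact (measurable_pi_apply n).comp measurable_snd

/-- An i.i.d. sequence is obtained by putting an independent copy in front of it. -/
theorem map_seqCons_prod_infinitePi {α : Type*} [MeasurableSpace α] (ν : Measure α)
    [IsProbabilityMeasure ν] :
    (ν.prod (Measure.infinitePi fun _ : ℕ => ν)).map (fun p => seqCons p.1 p.2) =
      Measure.infinitePi fun _ : ℕ => ν := by
  classical
  refine Measure.eq_infinitePi _ fun s t ht => ?_
  have hm : MeasurableSet (Set.pi (s : Set ℕ) t) :=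
    MeasurableSet.pi s.countable_toSet fun i hi => ht i
  rw [Measure.map_apply measurable_seqCons hm]
  obtain ⟨n, hn⟩ : ∃ n, s ⊆ Finset.range (n + 1) :=
    ⟨s.sup id, fun i hi => Finset.mem_range.2 (Nat.lt_succ_of_le (Finset.le_sup (f := id) hi))⟩
  -- Trivial constraints fill the gaps of `s`, so that the cylinder rests on an initial segment and
  -- splits into head and tail.
  set t' : ℕ → Set α := fun i => if i ∈ s then t i else univ with ht'
  have hpre : (fun p : α × (ℕ → α) => seqCons p.1 p.2) ⁻¹' Set.pi (s : Set ℕ) t =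
      t' 0 ×ˢ Set.pi (Finset.range n : Set ℕ) (fun i => t' (i + 1)) := by
    ext ⟨a, ω⟩
    simp only [mem_preimage, Set.mem_pi, mem_prod, Finset.mem_coe, Finset.mem_range, ht']
    constructor
    · intro h
      refine ⟨?_, fun i _ => ?_⟩
      · split_ifs with h0
        · exact h 0 h0
        · trivial
      · split_ifs with h0
        · exact h _ h0
        · trivial
    · rintro ⟨h0, h1⟩ i hi
      cases i with
      | zero => simpa [hi] using h0
      | succ i =>
        have := h1 i (by have := Finset.mem_range.1 (hn hi); omega)
        simpa [hi] using this
  rw [hpre, Measure.prod_prod, Measure.infinitePi_pi, mul_comm,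
    ← Finset.prod_range_succ' (fun i => ν (t' i))]
  · symm
    refine Finset.prod_subset_one_on_sdiff hn (fun i hi => ?_) (fun i hi => ?_)
    · simp [ht', (Finset.mem_sdiff.1 hi).2]
    · simp [ht', hi]
  · intro i _
    simp only [ht']
    split_ifs
    · exact ht _
    · exact MeasurableSet.univ

/-! ### Jump paths as deterministic functions of gaps and marks -/

section Paths

variable {S E : Type*}

/-- Given gaps between jumps and marks `ω`, exactly `m` jumps take place up to time `s`. -/
def HasJumpCount : ℕ → ℝ → (ℕ → ℝ × E) → Prop
  | 0, s, ω => s < (ω 0).1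
  | m + 1, s, ω => (ω 0).1 ≤ s ∧ HasJumpCount m (s - (ω 0).1) (fun n => ω (n + 1))

/-- The state after `m` jumps, when the jump with mark `e` takes `x` to `f x e`. -/
def stateAfter (f : S → E → S) : ℕ → S → (ℕ → ℝ × E) → S
  | 0, x, _ => x
  | m + 1, x, ω => stateAfter f m (f x (ω 0).2) (fun n => ω (n + 1))

theorem HasJumpCount.unique {m k : ℕ} {s : ℝ} {ω : ℕ → ℝ × E} (h : HasJumpCount m s ω)
    (h' : HasJumpCount k s ω) : m = k := by
  induction m generalizing k s ω with
  | zero =>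
    cases k with
    | zero => rfl
    | succ k => exact absurd h'.1 (not_le.2 h)
  | succ m ih =>
    cases k with
    | zero => exact absurd h.1 (not_le.2 h')
    | succ k => rw [ih h.2 h'.2]

theorem HasJumpCount.exists_of_le {m : ℕ} {s s' : ℝ} {ω : ℕ → ℝ × E} (h : HasJumpCount m s ω)
    (hs : s' ≤ s) : ∃ k, HasJumpCount k s' ω := by
  induction m generalizing s s' ω with
  | zero => exact ⟨0, hs.trans_lt h⟩
  | succ m ih =>
    by_cases hu : s' < (ω 0).1
    · exact ⟨0, hu⟩
    · obtain ⟨k, hk⟩ := ih h.2 (sub_le_sub_right hs _)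
      exact ⟨k + 1, not_lt.1 hu, hk⟩

open Classical in
/-- The state at time `s` of the jump path started at `x` with gaps between jumps and marks `ω`;
it is `d` after an explosion. -/
noncomputable def jumpPath (f : S → E → S) (d x : S) (ω : ℕ → ℝ × E) (s : ℝ) : S :=
  if h : ∃ m, HasJumpCount m s ω then stateAfter f h.choose x ω else d

variable {f : S → E → S} {d x : S} {ω : ℕ → ℝ × E} {s : ℝ}

theorem jumpPath_eq {m : ℕ} (h : HasJumpCount m s ω) :
    jumpPath f d x ω s = stateAfter f m x ω := by
  have h' : ∃ m, HasJumpCount m s ω := ⟨m, h⟩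
  rw [jumpPath, dif_pos h', h'.choose_spec.unique h]

theorem jumpPath_of_lt (h : s < (ω 0).1) : jumpPath f d x ω s = x :=
  jumpPath_eq (m := 0) h

theorem jumpPath_of_le (h : (ω 0).1 ≤ s) :
    jumpPath f d x ω s = jumpPath f d (f x (ω 0).2) (fun n => ω (n + 1)) (s - (ω 0).1) := by
  by_cases h' : ∃ m, HasJumpCount m (s - (ω 0).1) (fun n => ω (n + 1))
  · obtain ⟨m, hm⟩ := h'
    rw [jumpPath_eq hm, jumpPath_eq (m := m + 1) ⟨h, hm⟩]
    rfl
  · have h'' : ¬ ∃ m, HasJumpCount m s ω := by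
      rintro ⟨m, hm⟩
      cases m with
      | zero => exact absurd h (not_le.2 hm)
      | succ m => exact h' ⟨m, hm.2⟩
    rw [jumpPath, jumpPath, dif_neg h', dif_neg h'']

theorem stateAfter_mem {T : Set S} (hT : ∀ x ∈ T, ∀ e, f x e ∈ T) (hx : x ∈ T) (m : ℕ) :
    stateAfter f m x ω ∈ T := by
  induction m generalizing x ω with
  | zero => exact hx
  | succ m ih => exact ih (hT x hx _)

/-- The jumps up to `s` are common to both counts; the remaining ones start inside `T` and cannot
leave it. The initial state itself need not lie in `T`. -/
theorem stateAfter_mem_of_le {T : Set S} (hT : ∀ x ∈ T, ∀ e, f x e ∈ T) {m k : ℕ} {t : ℝ}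
    (hm : HasJumpCount m s ω) (hk : HasJumpCount k t ω) (hst : s ≤ t)
    (hx : stateAfter f m x ω ∈ T) : stateAfter f k x ω ∈ T := by
  induction m generalizing x s t k ω with
  | zero => exact stateAfter_mem hT hx k
  | succ m ih =>
    cases k with
    | zero => exact absurd (hm.1.trans hst) (not_le.2 hk)
    | succ k =>
      have := ih (x := f x (ω 0).2) hm.2 hk.2 (sub_le_sub_right hst _) hx
      exact this

theorem eventually_jumpPath_eq_right {m : ℕ} (h : HasJumpCount m s ω) :
    ∀ᶠ r in nhdsWithin s (Ioi s), jumpPath f d x ω r = jumpPath f d x ω s := by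
  induction m generalizing x s ω with
  | zero =>
    filter_upwards [mem_nhdsWithin_of_mem_nhds (Iio_mem_nhds h)] with r hr
    rw [jumpPath_of_lt h, jumpPath_of_lt hr]
  | succ m ih =>
    have ht : Tendsto (fun r => r - (ω 0).1) (nhdsWithin s (Ioi s))
        (nhdsWithin (s - (ω 0).1) (Ioi (s - (ω 0).1))) := by
      refine tendsto_nhdsWithin_iff.2 ⟨?_, ?_⟩
      · exact ((continuous_sub_right _).tendsto s).mono_left nhdsWithin_le_nhds
      · filter_upwards [self_mem_nhdsWithin] with r hr using sub_lt_sub_right (mem_Ioi.1 hr) _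
    filter_upwards [ht.eventually (ih (x := f x (ω 0).2) h.2), self_mem_nhdsWithin] with r hr hr'
    rw [jumpPath_of_le h.1, jumpPath_of_le (h.1.trans (le_of_lt hr')), hr]

theorem exists_eventually_jumpPath_eq_left {m : ℕ} (h : HasJumpCount m s ω) :
    ∃ l, ∀ᶠ r in nhdsWithin s (Iio s), jumpPath f d x ω r = l := by
  induction m generalizing x s ω with
  | zero =>
    refine ⟨x, ?_⟩
    filter_upwards [self_mem_nhdsWithin] with r hr
    exact jumpPath_of_lt (lt_trans hr h)
  | succ m ih =>
    -- If `s` is exactly the first jump time, the left limit is the state before the jump.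
    rcases h.1.eq_or_lt with hu | hu
    · refine ⟨x, ?_⟩
      filter_upwards [self_mem_nhdsWithin] with r hr
      exact jumpPath_of_lt (hu ▸ hr)
    · obtain ⟨l, hl⟩ := ih (x := f x (ω 0).2) h.2
      have ht : Tendsto (fun r => r - (ω 0).1) (nhdsWithin s (Iio s))
          (nhdsWithin (s - (ω 0).1) (Iio (s - (ω 0).1))) := by
        refine tendsto_nhdsWithin_iff.2 ⟨?_, ?_⟩
        · exact ((continuous_sub_right _).tendsto s).mono_left nhdsWithin_le_nhds
        · filter_upwards [self_mem_nhdsWithin] with r hr using sub_lt_sub_right (mem_Iio.1 hr) _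
      refine ⟨l, ?_⟩
      filter_upwards [ht.eventually hl, mem_nhdsWithin_of_mem_nhds (Ioi_mem_nhds hu)] with r hr hr'
      rw [jumpPath_of_le (le_of_lt hr'), hr]

variable [MeasurableSpace E]

theorem measurableSet_hasJumpCount (m : ℕ) (s : ℝ) :
    MeasurableSet {ω : ℕ → ℝ × E | HasJumpCount m s ω} := by
  -- Joint measurability in time and path is needed: the recursion shifts the time by a random gap.
  have key : MeasurableSet {p : ℝ × (ℕ → ℝ × E) | HasJumpCount m p.1 p.2} := by
    induction m with
    | zero =>
      exact measurableSet_lt measurable_fst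
        (measurable_fst.comp ((measurable_pi_apply 0).comp measurable_snd))
    | succ m ih =>
      refine MeasurableSet.inter (measurableSet_le (by fun_prop) measurable_fst) ?_
      have hm : Measurable (fun p : ℝ × (ℕ → ℝ × E) =>
          (p.1 - (p.2 0).1, fun n => p.2 (n + 1))) := by fun_prop
      exact hm ih
  exact (measurable_prodMk_left (x := s)) key

theorem measurableSet_stateAfter_eq [DiscreteMeasurableSpace E] [Countable E] (f : S → E → S)
    (m : ℕ) (x y : S) :
    MeasurableSet {ω : ℕ → ℝ × E | stateAfter f m x ω = y} := by
  induction m generalizing x with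
  | zero => exact MeasurableSet.const (x = y)
  | succ m ih =>
    have : {ω : ℕ → ℝ × E | stateAfter f (m + 1) x ω = y} =
        ⋃ e : E, {ω | (ω 0).2 = e} ∩
          (fun (ω : ℕ → ℝ × E) n => ω (n + 1)) ⁻¹' {ω | stateAfter f m (f x e) ω = y} := by
      ext ω
      simp [stateAfter]
    rw [this]
    refine MeasurableSet.iUnion fun e => MeasurableSet.inter ?_ ?_
    · exact (measurable_snd.comp (measurable_pi_apply 0)) (measurableSet_singleton e)
    · exact (show Measurable (fun (ω : ℕ → ℝ × E) n => ω (n + 1)) by fun_prop) (ih _)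

theorem measurableSet_jumpPath_eq [DiscreteMeasurableSpace E] [Countable E] (f : S → E → S)
    (d x y : S) (s : ℝ) :
    MeasurableSet {ω : ℕ → ℝ × E | jumpPath f d x ω s = y} := by
  have : {ω : ℕ → ℝ × E | jumpPath f d x ω s = y} =
      (⋃ m, {ω | HasJumpCount m s ω} ∩ {ω | stateAfter f m x ω = y}) ∪
        ((⋃ m, {ω | HasJumpCount m s ω})ᶜ ∩ {_ω | d = y}) := by
    ext ω
    by_cases h : ∃ m, HasJumpCount m s ω
    · obtain ⟨m, hm⟩ := h
      simp only [mem_ofPred_eq, jumpPath_eq hm, mem_union, mem_iUnion, mem_inter_iff, mem_compl_iff]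
      constructor
      · exact fun hy => Or.inl ⟨m, hm, hy⟩
      · rintro (⟨k, hk, hy⟩ | ⟨hk, -⟩)
        · rwa [hm.unique hk]
        · exact absurd ⟨m, hm⟩ hk
    · have h' : ∀ m, ¬ HasJumpCount m s ω := fun m hm => h ⟨m, hm⟩
      simp [jumpPath, h']
  rw [this]
  exact (MeasurableSet.iUnion fun m => (measurableSet_hasJumpCount m s).inter
    (measurableSet_stateAfter_eq f m x y)).union
    ((MeasurableSet.iUnion fun m => measurableSet_hasJumpCount m s).compl.inter
      (MeasurableSet.const _))

end Paths

/-! ### Uniformization of the matrix exponential -/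

open scoped Matrix.Norms.Operator in
theorem hasSum_matrix_exp {S : Type*} [Fintype S] [DecidableEq S] (A : Matrix S S ℝ) (i j : S) :
    HasSum (fun m : ℕ => (A ^ m) i j / m.factorial) (NormedSpace.exp A i j) := by
  have h := NormedSpace.exp_series_hasSum_exp' (𝕂 := ℝ) A
  have h2 := Pi.hasSum.1 (Pi.hasSum.1 h i) j
  have h3 : (fun m : ℕ => (A ^ m) i j / m.factorial) =
      fun m : ℕ => ((m.factorial : ℝ)⁻¹ • A ^ m) i j := by
    ext m
    rw [Matrix.smul_apply, smul_eq_mul, div_eq_inv_mul]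
  rw [h3]
  exact h2

/-- Uniformization of the transition matrix. -/
theorem hasSum_transitionMatrix {S : Type*} [Fintype S] [DecidableEq S] (P : Matrix S S ℝ)
    (Λ s : ℝ) (i j : S) :
    HasSum (fun m : ℕ => Real.exp (-(Λ * s)) * (Λ * s) ^ m / m.factorial * (P ^ m) i j)
      (transitionMatrix (Λ • (P - 1)) s i j) := by
  -- The second summand is scalar, so it commutes with `P` and its exponential factors out as the
  -- Poisson normalization.
  have h1 : s • Λ • (P - 1) = (Λ * s) • P + Matrix.diagonal (fun _ => -(Λ * s)) := by
    ext a b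
    by_cases hab : a = b
    · subst hab; simp; ring
    · simp [hab]; ring
  have hc : Commute ((Λ * s) • P) (Matrix.diagonal (fun _ : S => -(Λ * s))) := by
    rw [← Matrix.smul_one_eq_diagonal]
    exact (Commute.one_right _).smul_right _
  have h2 : transitionMatrix (Λ • (P - 1)) s i j =
      Real.exp (-(Λ * s)) * NormedSpace.exp ((Λ * s) • P) i j := by
    rw [transitionMatrix, h1, Matrix.exp_add_of_commute _ _ hc, Matrix.exp_diagonal,
      Matrix.mul_diagonal, mul_comm, Real.exp_eq_exp_ℝ]
    congr 1
    exact _root_.Pi.coe_exp (fun _ : S => -(Λ * s)) j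
  rw [h2]
  have h3 : (fun m : ℕ => Real.exp (-(Λ * s)) * (Λ * s) ^ m / m.factorial * (P ^ m) i j) =
      fun m : ℕ => Real.exp (-(Λ * s)) * ((((Λ * s) • P) ^ m) i j / m.factorial) := by
    ext m
    rw [smul_pow, Matrix.smul_apply, smul_eq_mul]
    ring
  rw [h3]
  exact (hasSum_matrix_exp ((Λ * s) • P) i j).mul_left (Real.exp (-(Λ * s)))

/-- A first gap `u` followed by `m` jumps in the remaining time `s - u` makes `m + 1` jumps. The
exponentials multiply to a constant, leaving the integral of `(s - u) ^ m`. -/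
theorem integral_poisson_convolution (Λ s : ℝ) (m : ℕ) :
    ∫ u in (0 : ℝ)..s, Λ * Real.exp (-(Λ * u)) *
      (Real.exp (-(Λ * (s - u))) * (Λ * (s - u)) ^ m / m.factorial) =
      Real.exp (-(Λ * s)) * (Λ * s) ^ (m + 1) / (m + 1).factorial := by
  have h : ∀ u : ℝ, Λ * Real.exp (-(Λ * u)) *
      (Real.exp (-(Λ * (s - u))) * (Λ * (s - u)) ^ m / m.factorial) =
      (Λ ^ (m + 1) * Real.exp (-(Λ * s)) / m.factorial) * (s - u) ^ m := by
    intro u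
    have : Real.exp (-(Λ * s)) = Real.exp (-(Λ * u)) * Real.exp (-(Λ * (s - u))) := by
      rw [← Real.exp_add]; ring_nf
    rw [this, mul_pow]
    ring
  simp_rw [h]
  rw [intervalIntegral.integral_const_mul,
    intervalIntegral.integral_comp_sub_left (fun x : ℝ => x ^ m) s, integral_pow]
  have : (m.factorial : ℝ) ≠ 0 := by positivity
  rw [Nat.factorial_succ]
  push_cast
  field_simp
  simp [mul_pow]

/-! ### Markov property and finite-dimensional laws of lumped jump paths -/

section Law

variable {S S' E : Type*} [Fintype E] [MeasurableSpace E] [DiscreteMeasurableSpace E]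

/-- The law of a sequence of independent pairs of an exponential gap and a mark. -/
noncomputable def jumpMeasure (Λ : ℝ) (κ : PMF E) : Measure (ℕ → ℝ × E) :=
  Measure.infinitePi fun _ => (expMeasure Λ).prod κ.toMeasure

variable {Λ : ℝ} {κ : PMF E}

omit [Fintype E] [DiscreteMeasurableSpace E] in
theorem isProbabilityMeasure_jumpMeasure (hΛ : 0 < Λ) (κ : PMF E) :
    IsProbabilityMeasure (jumpMeasure Λ κ) := by
  have := isProbabilityMeasure_expMeasure hΛ
  unfold jumpMeasure
  infer_instance

/-- Conditioning on the first gap and the first mark. -/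
theorem jumpMeasure_apply (hΛ : 0 < Λ) {A : Set (ℕ → ℝ × E)} (hA : MeasurableSet A) :
    jumpMeasure Λ κ A = ∫⁻ u, exponentialPDF Λ u *
      ∑ e, κ e * jumpMeasure Λ κ (seqCons (u, e) ⁻¹' A) := by
  have := isProbabilityMeasure_expMeasure hΛ
  have := isProbabilityMeasure_jumpMeasure hΛ κ
  have hpre := measurable_seqCons hA
  have hsec : Measurable fun z : ℝ × E => jumpMeasure Λ κ (Prod.mk z ⁻¹'
      ((fun p : (ℝ × E) × (ℕ → ℝ × E) => seqCons p.1 p.2) ⁻¹' A)) :=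
    measurable_measure_prodMk_left hpre
  have h1 : jumpMeasure Λ κ A = ((((expMeasure Λ).prod κ.toMeasure).prod (jumpMeasure Λ κ)).map
      fun p => seqCons p.1 p.2) A := by
    unfold jumpMeasure
    rw [map_seqCons_prod_infinitePi]
  rw [h1, Measure.map_apply measurable_seqCons hA, Measure.prod_apply hpre,
    lintegral_prod _ hsec.aemeasurable]
  have h2 : expMeasure Λ = volume.withDensity (exponentialPDF Λ) := rfl
  have h3 : Measurable (exponentialPDF Λ) :=
    (measurable_exponentialPDFReal Λ).ennreal_ofReal
  rw [h2, lintegral_withDensity_eq_lintegral_mul _ h3 hsec.lintegral_prod_right']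
  refine lintegral_congr fun u => ?_
  rw [Pi.mul_apply, lintegral_fintype]
  congr 1
  refine Finset.sum_congr rfl fun e _ => ?_
  rw [PMF.toMeasure_apply_singleton _ _ (measurableSet_singleton e), mul_comm]
  rfl

variable [Fintype S'] [DecidableEq S'] {f : S → E → S} {d : S} {g : S → S'} {P : Matrix S' S' ℝ}

omit [MeasurableSpace E] [DiscreteMeasurableSpace E] in
-- First-step decomposition: by `hP`, the law of `g (f x e)` under a random mark depends on `x` only
-- through `g x`.
theorem sum_pow_lumped
    (hP : ∀ x y, ∑ e, (κ e).toReal * (if g (f x e) = y then 1 else 0) = P (g x) y)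
    (m : ℕ) (x : S) (y : S') :
    ∑ e, (κ e).toReal * (P ^ m) (g (f x e)) y = (P ^ (m + 1)) (g x) y := by
  rw [pow_succ', Matrix.mul_apply]
  simp_rw [← hP, Finset.sum_mul]
  rw [Finset.sum_comm]
  refine Finset.sum_congr rfl fun e _ => ?_
  simp

omit [MeasurableSpace E] [DiscreteMeasurableSpace E] in
theorem pow_lumped_nonneg
    (hP : ∀ x y, ∑ e, (κ e).toReal * (if g (f x e) = y then 1 else 0) = P (g x) y)
    (m : ℕ) (x : S) (y : S') : 0 ≤ (P ^ m) (g x) y := by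
  induction m generalizing x with
  | zero => rw [pow_zero, Matrix.one_apply]; split_ifs <;> norm_num
  | succ m ih =>
    rw [← sum_pow_lumped hP]
    exact Finset.sum_nonneg fun e _ => mul_nonneg ENNReal.toReal_nonneg (ih _)

/-- The Markov property at a time `s`, restricted to the event that `m` jumps took place. -/
theorem jumpMeasure_hasJumpCount_inter (hΛ : 0 < Λ)
    (hP : ∀ x y, ∑ e, (κ e).toReal * (if g (f x e) = y then 1 else 0) = P (g x) y)
    {F : (ℝ≥0 → S') → Prop} {y : S'} {c : ENNReal}
    (hF : ∀ x (s : ℝ), MeasurableSet {ω | F fun r => g (jumpPath f d x ω (s + r))})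
    (hg : ∀ x (s : ℝ), MeasurableSet {ω | g (jumpPath f d x ω s) = y})
    (hc : ∀ x, g x = y → jumpMeasure Λ κ {ω | F fun r => g (jumpPath f d x ω r)} = c)
    (m : ℕ) (x : S) {s : ℝ} (hs : 0 ≤ s) :
    jumpMeasure Λ κ {ω | HasJumpCount m s ω ∧ g (jumpPath f d x ω s) = y ∧
        F fun r => g (jumpPath f d x ω (s + r))} =
      ENNReal.ofReal (Real.exp (-(Λ * s)) * (Λ * s) ^ m / m.factorial * (P ^ m) (g x) y) * c := by
  have hprob := isProbabilityMeasure_jumpMeasure hΛ κ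
  have hmeas : ∀ m x s, MeasurableSet {ω | HasJumpCount m s ω ∧ g (jumpPath f d x ω s) = y ∧
        F fun r => g (jumpPath f d x ω (s + r))} := fun m x s =>
    (measurableSet_hasJumpCount m s).inter ((hg x s).inter (hF x s))
  induction m generalizing x s with
  | zero =>
    by_cases hxy : g x = y
    · have h0 : MeasurableSet {ω | F fun r => g (jumpPath f d x ω r)} := by
        simpa using hF x 0
      -- Memorylessness: the first gap is written `v + s`, and the density at `v + s` is `exp (-(Λ *
      -- s))` times that at `v`. The point `v = 0` is discarded, since a jump at time `s` already
      -- counts.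
      rw [jumpMeasure_apply hΛ (hmeas _ _ _), ← hc x hxy, jumpMeasure_apply hΛ h0,
        ← lintegral_const_mul' _ _ ENNReal.ofReal_ne_top, ← lintegral_add_right_eq_self _ s]
      refine lintegral_congr_ae ?_
      filter_upwards [compl_mem_ae_iff.2 (Real.volume_singleton (a := (0 : ℝ)))] with v hv
      rcases lt_or_gt_of_ne (show v ≠ 0 from hv) with hv | hv
      · rw [exponentialPDF_of_neg hv]
        have : ∀ e : E, seqCons (v + s, e) ⁻¹' {ω | HasJumpCount 0 s ω ∧
            g (jumpPath f d x ω s) = y ∧ F fun r => g (jumpPath f d x ω (s + r))} = ∅ := by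
          intro e
          ext ω
          simp only [mem_preimage, mem_ofPred_eq, mem_empty_iff_false, iff_false, HasJumpCount,
            seqCons_zero]
          intro h
          linarith [h.1]
        rw [zero_mul, mul_zero, Finset.sum_eq_zero fun e _ => by
          rw [this e, measure_empty, mul_zero], mul_zero]
      · rw [exponentialPDF_of_nonneg hv.le, exponentialPDF_of_nonneg (by linarith), ← mul_assoc,
          ← ENNReal.ofReal_mul (by simp only [pow_zero, hxy, Matrix.one_apply_eq]; positivity)]
        congr 1
        · congr 1
          simp only [pow_zero, hxy, Matrix.one_apply_eq, Nat.factorial_zero, Nat.cast_one]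
          rw [mul_add, neg_add, Real.exp_add]
          ring
        · refine Finset.sum_congr rfl fun e _ => ?_
          congr 2
          ext ω
          have hlt : s < (seqCons (v + s, e) ω 0).1 := by simpa using hv
          have heq : ∀ r : ℝ, jumpPath f d x (seqCons (v + s, e) ω) (s + r) =
              jumpPath f d x (seqCons (v, e) ω) r := by
            intro r
            by_cases hr : r < v
            · have h1 : s + r < (seqCons (v + s, e) ω 0).1 := by
                simp only [seqCons_zero]; linarith
              have h2 : r < (seqCons (v, e) ω 0).1 := hr
              rw [jumpPath_of_lt h1, jumpPath_of_lt h2]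
            · have h1 : (seqCons (v + s, e) ω 0).1 ≤ s + r := by
                simp only [seqCons_zero]; linarith
              have h2 : (seqCons (v, e) ω 0).1 ≤ r := not_lt.1 hr
              rw [jumpPath_of_le h1, jumpPath_of_le h2]
              simp only [seqCons_zero, seqCons_succ]
              congr 1
              ring
          simp only [mem_preimage, mem_ofPred_eq, HasJumpCount, hlt, jumpPath_of_lt hlt, hxy,
            heq, true_and]
    · have : {ω | HasJumpCount 0 s ω ∧ g (jumpPath f d x ω s) = y ∧
          F fun r => g (jumpPath f d x ω (s + r))} = ∅ := by
        ext ω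
        simp only [mem_ofPred_eq, mem_empty_iff_false, iff_false]
        rintro ⟨h1, h2, -⟩
        rw [jumpPath_of_lt h1] at h2
        exact hxy h2
      simp [this, hxy]
  | succ m ih =>
    have ha := pow_lumped_nonneg hP (m + 1) x y
    -- Given a first gap `u` in `[0, s]`, the path restarts from `f x e` with `m` jumps in time `s -
    -- u`; averaging over `e` turns `P ^ m` into `P ^ (m + 1)`.
    have hint : ∀ u, exponentialPDF Λ u * ∑ e, κ e * jumpMeasure Λ κ (seqCons (u, e) ⁻¹'
        {ω | HasJumpCount (m + 1) s ω ∧ g (jumpPath f d x ω s) = y ∧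
          F fun r => g (jumpPath f d x ω (s + r))}) =
        (Icc 0 s).indicator (fun u => ENNReal.ofReal (Λ * Real.exp (-(Λ * u)) *
          (Real.exp (-(Λ * (s - u))) * (Λ * (s - u)) ^ m / m.factorial))) u *
          (ENNReal.ofReal ((P ^ (m + 1)) (g x) y) * c) := by
      intro u
      by_cases hu0 : u < 0
      · rw [exponentialPDF_of_neg hu0, indicator_of_notMem (fun h => absurd h.1 (not_le.2 hu0))]
        simp
      rw [not_lt] at hu0
      by_cases hus : u ≤ s
      · have hsu : 0 ≤ s - u := sub_nonneg.2 hus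
        rw [indicator_of_mem (show u ∈ Icc 0 s from ⟨hu0, hus⟩), exponentialPDF_of_nonneg hu0,
          ENNReal.ofReal_mul (p := Λ * Real.exp (-(Λ * u))) (by positivity), mul_assoc,
          ← sum_pow_lumped hP]
        congr 1
        rw [← mul_assoc, ENNReal.ofReal_sum_of_nonneg fun e _ =>
          mul_nonneg ENNReal.toReal_nonneg (pow_lumped_nonneg hP _ _ _), Finset.mul_sum,
          Finset.sum_mul]
        refine Finset.sum_congr rfl fun e _ => ?_
        have hset : seqCons (u, e) ⁻¹' {ω | HasJumpCount (m + 1) s ω ∧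
            g (jumpPath f d x ω s) = y ∧ F fun r => g (jumpPath f d x ω (s + r))} =
            {ω | HasJumpCount m (s - u) ω ∧ g (jumpPath f d (f x e) ω (s - u)) = y ∧
              F fun r => g (jumpPath f d (f x e) ω (s - u + r))} := by
          ext ω
          have heq : ∀ r : ℝ≥0, jumpPath f d x (seqCons (u, e) ω) (s + r) =
              jumpPath f d (f x e) ω (s - u + r) := by
            intro r
            rw [jumpPath_of_le (by simp only [seqCons_zero]; linarith [r.2])]
            simp only [seqCons_zero, seqCons_succ]
            congr 1
            ring
          have heq0 : jumpPath f d x (seqCons (u, e) ω) s = jumpPath f d (f x e) ω (s - u) := by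
            simpa using heq 0
          simp only [mem_preimage, mem_ofPred_eq, heq, heq0, HasJumpCount, seqCons_zero,
            seqCons_succ, hus, true_and]
        rw [hset, ih _ hsu, ENNReal.ofReal_mul (by positivity), ENNReal.ofReal_mul (by positivity),
          ENNReal.ofReal_toReal (PMF.apply_ne_top κ e)]
        ring
      · rw [indicator_of_notMem (fun h => hus h.2)]
        have : ∀ e : E, seqCons (u, e) ⁻¹' {ω | HasJumpCount (m + 1) s ω ∧
            g (jumpPath f d x ω s) = y ∧ F fun r => g (jumpPath f d x ω (s + r))} = ∅ := by
          intro e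
          ext ω
          simp only [mem_preimage, mem_ofPred_eq, mem_empty_iff_false, iff_false, HasJumpCount,
            seqCons_zero]
          exact fun h => hus h.1.1
        rw [zero_mul, Finset.sum_eq_zero fun e _ => by
          rw [this e, measure_empty, mul_zero], mul_zero]
    have hcont : Continuous fun u : ℝ => Λ * Real.exp (-(Λ * u)) *
          (Real.exp (-(Λ * (s - u))) * (Λ * (s - u)) ^ m / m.factorial) := by fun_prop
    rw [jumpMeasure_apply hΛ (hmeas _ _ _), lintegral_congr hint,
      lintegral_mul_const _ (hcont.measurable.ennreal_ofReal.indicator measurableSet_Icc),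
      lintegral_indicator measurableSet_Icc, ← mul_assoc, ENNReal.ofReal_mul (by positivity),
      ← integral_poisson_convolution, intervalIntegral.integral_of_le hs,
      ← integral_Icc_eq_integral_Ioc, ofReal_integral_eq_lintegral_ofReal]
    · exact hcont.integrableOn_Icc
    · refine (ae_restrict_iff' measurableSet_Icc).2 (Eventually.of_forall fun u hu => ?_)
      have : 0 ≤ s - u := sub_nonneg.2 hu.2
      simp only [Pi.zero_apply]
      positivity

/-- No explosion: on a one-point state space the preceding formula says that the number of jumps is
Poisson, and the Poisson weights sum to one. -/
theorem ae_exists_hasJumpCount (hΛ : 0 < Λ) (κ : PMF E) {s : ℝ} (hs : 0 ≤ s) :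
    ∀ᵐ ω ∂jumpMeasure Λ κ, ∃ m, HasJumpCount m s ω := by
  have hprob := isProbabilityMeasure_jumpMeasure hΛ κ
  have h := fun m => jumpMeasure_hasJumpCount_inter (κ := κ) (f := fun (_ : Unit) (_ : E) => ())
    (d := ()) (g := id) (P := 1) hΛ (fun _ _ => by
      have := κ.tsum_coe
      rw [tsum_fintype] at this
      simp only [if_true, mul_one, Matrix.one_apply]
      rw [← ENNReal.toReal_sum fun e _ => κ.apply_ne_top e, this]
      rfl) (F := fun _ => True) (y := ()) (c := 1) (by simp) (by simp) (by simp) m () hs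
  have hU : MeasurableSet (⋃ m, {ω : ℕ → ℝ × E | HasJumpCount m s ω}) :=
    MeasurableSet.iUnion fun m => measurableSet_hasJumpCount m s
  have h1 : jumpMeasure Λ κ (⋃ m, {ω | HasJumpCount m s ω}) = 1 := by
    have hd : Pairwise (Function.onFun Disjoint fun m : ℕ =>
        {ω : ℕ → ℝ × E | HasJumpCount m s ω}) := fun i j hij =>
      Set.disjoint_left.2 fun ω hi hj => hij (HasJumpCount.unique hi hj)
    rw [measure_iUnion hd fun m => measurableSet_hasJumpCount m s]
    have h2 := hasSum_transitionMatrix (1 : Matrix Unit Unit ℝ) Λ s () ()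
    simp only [one_pow, Matrix.one_apply_eq, id, and_true, mul_one] at h h2
    simp_rw [h]
    rw [← ENNReal.ofReal_tsum_of_nonneg (fun m => by positivity) h2.summable, h2.tsum_eq]
    simp [transitionMatrix]
  have h3 := (prob_compl_eq_zero_iff hU).2 h1
  filter_upwards [compl_mem_ae_iff.2 h3] with ω hω
  simpa using hω

/-- The Markov property of the image under `g` at a time `s`. -/
theorem jumpMeasure_jumpPath_inter (hΛ : 0 < Λ)
    (hP : ∀ x y, ∑ e, (κ e).toReal * (if g (f x e) = y then 1 else 0) = P (g x) y)
    {F : (ℝ≥0 → S') → Prop} {y : S'} {c : ENNReal}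
    (hF : ∀ x (s : ℝ), MeasurableSet {ω | F fun r => g (jumpPath f d x ω (s + r))})
    (hg : ∀ x (s : ℝ), MeasurableSet {ω | g (jumpPath f d x ω s) = y})
    (hc : ∀ x, g x = y → jumpMeasure Λ κ {ω | F fun r => g (jumpPath f d x ω r)} = c)
    (x : S) {s : ℝ} (hs : 0 ≤ s) :
    jumpMeasure Λ κ {ω | g (jumpPath f d x ω s) = y ∧
        F fun r => g (jumpPath f d x ω (s + r))} =
      ENNReal.ofReal (transitionMatrix (Λ • (P - 1)) s (g x) y) * c := by
  have hsum := hasSum_transitionMatrix P Λ s (g x) y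
  rw [← hsum.tsum_eq, ENNReal.ofReal_tsum_of_nonneg (fun m =>
    mul_nonneg (by positivity) (pow_lumped_nonneg hP m x y)) hsum.summable,
    ← ENNReal.tsum_mul_right]
  simp_rw [← jumpMeasure_hasJumpCount_inter hΛ hP hF hg hc _ x hs]
  have hd : Pairwise (Function.onFun Disjoint fun m : ℕ => {ω | HasJumpCount m s ω ∧
      g (jumpPath f d x ω s) = y ∧ F fun r => g (jumpPath f d x ω (s + r))}) := fun i j hij =>
    Set.disjoint_left.2 fun ω hi hj => hij (HasJumpCount.unique hi.1 hj.1)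
  rw [← measure_iUnion hd fun m =>
    (measurableSet_hasJumpCount m s).inter ((hg x s).inter (hF x s))]
  refine measure_congr ?_
  filter_upwards [ae_exists_hasJumpCount hΛ κ hs] with ω hω
  refine propext ?_
  change (_ ∧ _) ↔ ω ∈ ⋃ m, _
  simp only [mem_iUnion, mem_ofPred_eq, exists_and_right, hω, true_and]

/-- The finite-dimensional distributions of the image under `g`. -/
theorem jumpMeasure_forall_jumpPath (hΛ : 0 < Λ)
    (hP : ∀ x y, ∑ e, (κ e).toReal * (if g (f x e) = y then 1 else 0) = P (g x) y)
    (hg : ∀ x y (s : ℝ), MeasurableSet {ω | g (jumpPath f d x ω s) = y})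
    (n : ℕ) (t : ℕ → ℝ≥0) (ht : Monotone t) (z : ℕ → S') (x : S) :
    jumpMeasure Λ κ {ω | ∀ i ≤ n, g (jumpPath f d x ω (t i)) = z i} =
      ENNReal.ofReal (transitionMatrix (Λ • (P - 1)) (t 0) (g x) (z 0)) *
        ∏ i ∈ Finset.range n, ENNReal.ofReal (transitionMatrix (Λ • (P - 1))
          ((t (i + 1) : ℝ) - (t i : ℝ)) (z i) (z (i + 1))) := by
  have hprob := isProbabilityMeasure_jumpMeasure hΛ κ
  induction n generalizing x t z with
  | zero =>
    have := jumpMeasure_jumpPath_inter (F := fun _ => True) (c := 1) hΛ hP (by simp)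
      (fun x s => hg x (z 0) s) (by simp) x (t 0).2
    simpa using this
  | succ n ih =>
    have hmono : Monotone fun i => t (i + 1) - t 0 := fun i j hij =>
      tsub_le_tsub_right (ht (Nat.succ_le_succ hij)) _
    have hcoe : ∀ i, ((t (i + 1) - t 0 : ℝ≥0) : ℝ) = t (i + 1) - t 0 := fun i =>
      NNReal.coe_sub (ht (Nat.zero_le _))
    -- The Markov property is applied at the first time `t 0`; the later constraints form the future
    -- event, whose probability depends only on `z 0`.
    have key := jumpMeasure_jumpPath_inter
      (F := fun φ : ℝ≥0 → S' => ∀ i ≤ n, φ (t (i + 1) - t 0) = z (i + 1))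
      (c := ENNReal.ofReal (transitionMatrix (Λ • (P - 1)) ((t 1 : ℝ) - t 0) (z 0) (z 1)) *
        ∏ i ∈ Finset.range n, ENNReal.ofReal (transitionMatrix (Λ • (P - 1))
          ((t (i + 2) : ℝ) - (t (i + 1) : ℝ)) (z (i + 1)) (z (i + 2)))) hΛ hP
      (fun x s => by
        simp only [ofPred_forall]
        exact MeasurableSet.iInter fun i => MeasurableSet.iInter fun _ => hg _ _ _)
      (fun x s => hg x (z 0) s) (fun x0 hx0 => by
        rw [ih _ hmono (fun i => z (i + 1)) x0, hx0]
        simp only [hcoe, sub_sub_sub_cancel_right]) x (t 0).2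
    rw [Finset.prod_range_succ', mul_comm (Finset.prod _ _)]
    refine Eq.trans ?_ key
    congr 1
    ext ω
    simp only [mem_ofPred_eq, hcoe, NNReal.val_eq_coe, add_sub_cancel]
    constructor
    · exact fun h => ⟨h 0 (Nat.zero_le _), fun i hi => h (i + 1) (Nat.succ_le_succ hi)⟩
    · rintro ⟨h0, h1⟩ i hi
      cases i with
      | zero => exact h0
      | succ i => exact h1 i (Nat.le_of_succ_le_succ hi)

end Law

/-! ### Processes with random initial state and regular paths -/

section JumpProcesses

variable {S S' E : Type*}

open Classical in
/-- The jump process with random initial state `ω.1`; explosive paths are replaced by constants. -/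
noncomputable def jumpProcess (f : S → E → S) (t : ℝ≥0) (ω : S × (ℕ → ℝ × E)) : S :=
  -- Integer times suffice, so only countably many almost sure conditions are imposed; constants
  -- elsewhere make every path regular.
  if ∀ n : ℕ, ∃ m, HasJumpCount m n ω.2 then jumpPath f ω.1 ω.1 ω.2 t else ω.1

theorem exists_hasJumpCount_of_forall_nat {ω : ℕ → ℝ × E}
    (h : ∀ n : ℕ, ∃ m, HasJumpCount m n ω) (s : ℝ) : ∃ m, HasJumpCount m s ω := by
  obtain ⟨n, hn⟩ := exists_nat_ge s
  obtain ⟨m, hm⟩ := h n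
  exact hm.exists_of_le hn

/-- A set which the jumps do not leave is not left by the jump process. -/
theorem jumpProcess_mem_of_le {f : S → E → S} {T : Set S} (hT : ∀ x ∈ T, ∀ e, f x e ∈ T)
    {ω : S × (ℕ → ℝ × E)} {s t : ℝ≥0} (hst : s ≤ t) (hs : jumpProcess f s ω ∈ T) :
    jumpProcess f t ω ∈ T := by
  unfold jumpProcess at *
  split_ifs at * with h
  · obtain ⟨m, hm⟩ := exists_hasJumpCount_of_forall_nat h s
    obtain ⟨k, hk⟩ := exists_hasJumpCount_of_forall_nat h t
    rw [jumpPath_eq hm] at hs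
    rw [jumpPath_eq hk]
    exact stateAfter_mem_of_le hT hm hk (NNReal.coe_le_coe.2 hst) hs
  · exact hs

theorem jumpProcess_right_continuous (f : S → E → S) (ω : S × (ℕ → ℝ × E)) (t : ℝ≥0) :
    ∀ᶠ s in nhdsWithin t (Ioi t), jumpProcess f s ω = jumpProcess f t ω := by
  unfold jumpProcess
  split_ifs with h
  · obtain ⟨m, hm⟩ := exists_hasJumpCount_of_forall_nat h t
    have ht : Tendsto (fun s : ℝ≥0 => (s : ℝ)) (nhdsWithin t (Ioi t))
        (nhdsWithin (t : ℝ) (Ioi (t : ℝ))) :=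
      tendsto_nhdsWithin_iff.2 ⟨(NNReal.continuous_coe.tendsto t).mono_left nhdsWithin_le_nhds,
        by filter_upwards [self_mem_nhdsWithin] with s hs using NNReal.coe_lt_coe.2 hs⟩
    exact ht.eventually (eventually_jumpPath_eq_right hm)
  · exact Eventually.of_forall fun _ => rfl

theorem jumpProcess_left_limits (f : S → E → S) (ω : S × (ℕ → ℝ × E)) (t : ℝ≥0) :
    ∃ l, ∀ᶠ s in nhdsWithin t (Iio t), jumpProcess f s ω = l := by
  unfold jumpProcess
  split_ifs with h
  · obtain ⟨m, hm⟩ := exists_hasJumpCount_of_forall_nat h t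
    obtain ⟨l, hl⟩ := exists_eventually_jumpPath_eq_left (f := f) (d := ω.1) (x := ω.1) hm
    have ht : Tendsto (fun s : ℝ≥0 => (s : ℝ)) (nhdsWithin t (Iio t))
        (nhdsWithin (t : ℝ) (Iio (t : ℝ))) :=
      tendsto_nhdsWithin_iff.2 ⟨(NNReal.continuous_coe.tendsto t).mono_left nhdsWithin_le_nhds,
        by filter_upwards [self_mem_nhdsWithin] with s hs using NNReal.coe_lt_coe.2 hs⟩
    exact ⟨l, ht.eventually hl⟩
  · exact ⟨ω.1, Eventually.of_forall fun _ => rfl⟩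

variable [Fintype E] [MeasurableSpace E] [DiscreteMeasurableSpace E]
  [Fintype S] [MeasurableSpace S] [DiscreteMeasurableSpace S]

theorem measurableSet_jumpPath_fst_eq (f : S → E → S) (x : S) (s : ℝ) :
    MeasurableSet {ω : S × (ℕ → ℝ × E) | jumpPath f ω.1 ω.1 ω.2 s = x} := by
  have : {ω : S × (ℕ → ℝ × E) | jumpPath f ω.1 ω.1 ω.2 s = x} =
      ⋃ y : S, {y} ×ˢ {ω | jumpPath f y y ω s = x} := by
    ext ⟨y, ω⟩
    simp
  rw [this]
  exact MeasurableSet.iUnion fun y =>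
    (measurableSet_singleton y).prod (measurableSet_jumpPath_eq f y y x s)

theorem measurableSet_jumpProcess_eq (f : S → E → S) (x : S) (t : ℝ≥0) :
    MeasurableSet {ω : S × (ℕ → ℝ × E) | jumpProcess f t ω = x} := by
  have hG : MeasurableSet {ω : S × (ℕ → ℝ × E) | ∀ n : ℕ, ∃ m, HasJumpCount m n ω.2} := by
    have : {ω : S × (ℕ → ℝ × E) | ∀ n : ℕ, ∃ m, HasJumpCount m n ω.2} =
        Prod.snd ⁻¹' ⋂ n : ℕ, ⋃ m, {ω | HasJumpCount m n ω} := by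
      ext ω
      simp
    rw [this]
    exact measurable_snd (MeasurableSet.iInter fun n => MeasurableSet.iUnion fun m =>
      measurableSet_hasJumpCount m n)
  have h := MeasurableSet.ite hG (measurableSet_jumpPath_fst_eq f x t)
    (measurable_fst (measurableSet_singleton x))
  convert h using 1
  ext ω
  by_cases hω : ∀ n : ℕ, ∃ m, HasJumpCount m n ω.2
  · simp [jumpProcess, Set.ite, hω]
  · simp only [jumpProcess, Set.ite, mem_ofPred_eq, mem_union, mem_inter_iff, Set.mem_sdiff, hω,
      and_false, false_or, not_false_eq_true, and_true, if_false]
    rfl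

variable {Λ : ℝ} {κ : PMF E} {f : S → E → S} {g : S → S'}

omit [Fintype S] [DiscreteMeasurableSpace S] in
theorem ae_jumpProcess_eq (hΛ : 0 < Λ) (μ : PMF S) :
    ∀ᵐ ω ∂μ.toMeasure.prod (jumpMeasure Λ κ), ∀ t : ℝ≥0,
      jumpProcess f t ω = jumpPath f ω.1 ω.1 ω.2 t := by
  have := isProbabilityMeasure_jumpMeasure hΛ κ
  have h : ∀ᵐ ω ∂jumpMeasure Λ κ, ∀ n : ℕ, ∃ m, HasJumpCount m n ω :=
    ae_all_iff.2 fun n => ae_exists_hasJumpCount hΛ κ n.cast_nonneg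
  have h' := (Measure.quasiMeasurePreserving_snd (μ := μ.toMeasure)
    (ν := jumpMeasure Λ κ)).ae h
  filter_upwards [h'] with ω hω t
  exact if_pos hω

variable [Fintype S'] [DecidableEq S'] {P : Matrix S' S' ℝ}

/-- The finite-dimensional distributions for a random initial state. -/
theorem measure_forall_jumpProcess (hΛ : 0 < Λ) (μ : PMF S)
    (hP : ∀ x y, ∑ e, (κ e).toReal * (if g (f x e) = y then 1 else 0) = P (g x) y)
    (n : ℕ) (t : ℕ → ℝ≥0) (ht : Monotone t) (z : ℕ → S') :
    (μ.toMeasure.prod (jumpMeasure Λ κ)) {ω | ∀ i ≤ n, g (jumpProcess f (t i) ω) = z i} =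
      (∑ x, μ x * ENNReal.ofReal (transitionMatrix (Λ • (P - 1)) (t 0) (g x) (z 0))) *
        ∏ i ∈ Finset.range n, ENNReal.ofReal (transitionMatrix (Λ • (P - 1))
          ((t (i + 1) : ℝ) - (t i : ℝ)) (z i) (z (i + 1))) := by
  have hprob := isProbabilityMeasure_jumpMeasure hΛ κ
  have hm : MeasurableSet {ω : S × (ℕ → ℝ × E) |
      ∀ i ≤ n, g (jumpPath f ω.1 ω.1 ω.2 (t i)) = z i} := by
    simp only [ofPred_forall]
    refine MeasurableSet.iInter fun i => MeasurableSet.iInter fun _ => ?_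
    have : {ω : S × (ℕ → ℝ × E) | g (jumpPath f ω.1 ω.1 ω.2 (t i)) = z i} =
        ⋃ y ∈ {y | g y = z i}, {ω | jumpPath f ω.1 ω.1 ω.2 (t i) = y} := by
      ext ω
      simp
    rw [this]
    exact MeasurableSet.biUnion (Set.to_countable _) fun y _ =>
      measurableSet_jumpPath_fst_eq f y _
  have hae : (μ.toMeasure.prod (jumpMeasure Λ κ))
      {ω | ∀ i ≤ n, g (jumpProcess f (t i) ω) = z i} =
      (μ.toMeasure.prod (jumpMeasure Λ κ))
        {ω | ∀ i ≤ n, g (jumpPath f ω.1 ω.1 ω.2 (t i)) = z i} := by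
    refine measure_congr ?_
    filter_upwards [ae_jumpProcess_eq (f := f) hΛ μ] with ω hω
    refine propext ?_
    change (∀ i ≤ n, g (jumpProcess f (t i) ω) = z i) ↔
      ∀ i ≤ n, g (jumpPath f ω.1 ω.1 ω.2 (t i)) = z i
    simp only [hω]
  rw [hae, Measure.prod_apply hm, lintegral_fintype, Finset.sum_mul]
  refine Finset.sum_congr rfl fun x _ => ?_
  rw [PMF.toMeasure_apply_singleton _ _ (measurableSet_singleton x), mul_comm, mul_assoc]
  congr 1
  refine jumpMeasure_forall_jumpPath hΛ hP (fun x' y s => ?_) n t ht z x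
  have : {ω : ℕ → ℝ × E | g (jumpPath f x x' ω s) = y} =
      ⋃ y' ∈ {y' | g y' = y}, {ω | jumpPath f x x' ω s = y'} := by
    ext ω
    simp
  rw [this]
  exact MeasurableSet.biUnion (Set.to_countable _) fun y _ => measurableSet_jumpPath_eq f _ _ _ _

theorem isMarkovJumpProcess_jumpProcess (hΛ : 0 < Λ) (μ : PMF S)
    (hP : ∀ x y, ∑ e, (κ e).toReal * (if g (f x e) = y then 1 else 0) = P (g x) y)
    (hg : Function.Surjective g) :
    IsMarkovJumpProcess (Λ • (P - 1)) (μ.toMeasure.prod (jumpMeasure Λ κ))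
      (fun t ω => g (jumpProcess f t ω)) where
  measurableSet_eq t y := by
    have : {ω : S × (ℕ → ℝ × E) | g (jumpProcess f t ω) = y} =
        ⋃ x ∈ {x | g x = y}, {ω | jumpProcess f t ω = x} := by
      ext ω
      simp
    rw [this]
    exact MeasurableSet.biUnion (Set.to_countable _) fun x _ =>
      measurableSet_jumpProcess_eq f x t
  right_continuous ω t := (jumpProcess_right_continuous f ω t).mono fun s hs => by rw [hs]
  left_limits ω t := by
    obtain ⟨l, hl⟩ := jumpProcess_left_limits f ω t
    exact ⟨g l, hl.mono fun s hs => by rw [hs]⟩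
  finite_dim n t z ht := by
    have h0 := measure_forall_jumpProcess hΛ μ hP 0 t ht z
    simp only [Nat.le_zero, forall_eq, Finset.range_zero, Finset.prod_empty, mul_one] at h0
    rw [Measure.real, Measure.real, measure_forall_jumpProcess hΛ μ hP n t ht z, h0,
      ENNReal.toReal_mul, ENNReal.toReal_prod]
    congr 1
    refine Finset.prod_congr rfl fun i _ => ENNReal.toReal_ofReal ?_
    -- Nonnegativity of the transition probabilities is known only on rows in the range of `g`,
    -- whence surjectivity.
    obtain ⟨x, hx⟩ := hg (z i)
    have hs : 0 ≤ (t (i + 1) : ℝ) - t i := sub_nonneg.2 (ht (Nat.le_succ i))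
    rw [← (hasSum_transitionMatrix P Λ _ _ _).tsum_eq, ← hx]
    exact tsum_nonneg fun m => mul_nonneg (by positivity) (pow_lumped_nonneg hP _ _ _)

/-- The law on marks proportional to the rates `r`. -/
noncomputable def markLaw (r : E → ℝ) (hr : ∀ e, 0 ≤ r e) (hsum : 0 < ∑ e, r e) : PMF E :=
  PMF.ofFintype (fun e => ENNReal.ofReal (r e / ∑ e, r e)) (by
    rw [← ENNReal.ofReal_sum_of_nonneg fun e _ => div_nonneg (hr e) hsum.le, ← Finset.sum_div,
      div_self hsum.ne', ENNReal.ofReal_one])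

/-- If every mark `e` occurs at rate `r e` and takes `x` to `f x e`, then the image under `g` is a
Markov jump process with generator `Q`, provided that the rates of its jumps out of `x` are those
of `Q` out of `g x`. -/
theorem isMarkovJumpProcess_of_rates {r : E → ℝ} (hr : ∀ e, 0 ≤ r e) (hsum : 0 < ∑ e, r e)
    (μ : PMF S) {Q : Matrix S' S' ℝ} (hg : Function.Surjective g)
    (hQ : ∀ x y, ∑ e, r e * ((if g (f x e) = y then 1 else 0) - (if g x = y then 1 else 0)) =
      Q (g x) y) :
    IsMarkovJumpProcess Q (μ.toMeasure.prod (jumpMeasure (∑ e, r e) (markLaw r hr hsum)))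
      (fun t ω => g (jumpProcess f t ω)) := by
  have hne := hsum.ne'
  -- The one-step matrix of the uniformized chain is `1 + Λ⁻¹ Q`, with `Λ` the total rate.
  have h1 : (∑ e, r e) • ((1 + (∑ e, r e)⁻¹ • Q) - 1) = Q := by
    rw [add_sub_cancel_left, smul_smul, mul_inv_cancel₀ hne, one_smul]
  have h2 := isMarkovJumpProcess_jumpProcess (κ := markLaw r hr hsum) (f := f) (g := g)
    (P := 1 + (∑ e, r e)⁻¹ • Q) hsum μ (fun x y => by
      have h3 : ∀ e, (markLaw r hr hsum e).toReal = r e / ∑ e, r e := fun e => by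
        rw [markLaw, PMF.ofFintype_apply, ENNReal.toReal_ofReal (div_nonneg (hr e) hsum.le)]
      simp_rw [h3]
      rw [Matrix.add_apply, Matrix.smul_apply, ← hQ, smul_eq_mul, Matrix.one_apply]
      simp_rw [mul_sub]
      rw [Finset.sum_sub_distrib, ← Finset.sum_mul, mul_sub, ← mul_assoc, inv_mul_cancel₀ hne,
        one_mul, add_sub_cancel, Finset.mul_sum]
      exact Finset.sum_congr rfl fun e _ => by ring) hg
  rwa [h1] at h2

/-- The initial state of the jump process has law `μ`. -/
theorem measure_jumpProcess_zero (hΛ : 0 < Λ) (μ : PMF S) (x : S) :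
    (μ.toMeasure.prod (jumpMeasure Λ κ)) {ω | jumpProcess f 0 ω = x} = μ x := by
  classical
  have h := measure_forall_jumpProcess (κ := κ) (f := f) (g := id)
    (P := Matrix.of fun x y => ∑ e, (κ e).toReal * (if f x e = y then 1 else 0)) hΛ μ
    (fun _ _ => rfl) 0 (fun _ => 0) monotone_const (fun _ => x)
  simpa [transitionMatrix, Matrix.one_apply, apply_ite ENNReal.ofReal] using h

end JumpProcesses

/-! ### Existence, uniqueness and images of invariant distributions -/

section Stationary

variable {S S' E : Type*} [Fintype S] [DecidableEq S] [Fintype S'] [DecidableEq S'] [Fintype E]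

theorem hasSum_vecMul_exp (v : S → ℝ) (A : Matrix S S ℝ) (y : S) :
    HasSum (fun m : ℕ => Matrix.vecMul v (A ^ m) y / m.factorial)
      (Matrix.vecMul v (NormedSpace.exp A) y) := by
  have h := hasSum_sum (s := Finset.univ) fun x _ => (hasSum_matrix_exp A x y).mul_left (v x)
  have h1 : (fun m : ℕ => Matrix.vecMul v (A ^ m) y / m.factorial) =
      fun m : ℕ => ∑ x, v x * ((A ^ m) x y / m.factorial) := by
    ext m
    simp only [Matrix.vecMul, dotProduct, Finset.sum_div, mul_div_assoc]
  rw [h1]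
  exact h

theorem vecMul_transitionMatrix {v : S → ℝ} {Q : Matrix S S ℝ} (h : Matrix.vecMul v Q = 0)
    (t : ℝ) : Matrix.vecMul v (transitionMatrix Q t) = v := by
  ext y
  have h1 := hasSum_vecMul_exp v (t • Q) y
  refine h1.unique ?_
  have h2 : ∀ m : ℕ, m ≠ 0 → Matrix.vecMul v ((t • Q) ^ m) y / m.factorial = 0 := by
    intro m hm
    obtain ⟨k, rfl⟩ := Nat.exists_eq_succ_of_ne_zero hm
    rw [Nat.succ_eq_add_one, pow_succ', ← Matrix.vecMul_vecMul, Matrix.vecMul_smul, h, smul_zero,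
      Matrix.zero_vecMul]
    simp
  simpa using hasSum_single 0 h2

open scoped Matrix.Norms.Operator in
theorem hasDerivAt_transitionMatrix (Q : Matrix S S ℝ) (t : ℝ) (x y : S) :
    HasDerivAt (fun u => transitionMatrix Q u x y) ((transitionMatrix Q t * Q) x y) t := by
  have h := hasDerivAt_exp_smul_const (𝕂 := ℝ) Q t
  exact hasDerivAt_pi.1 (hasDerivAt_pi.1 h x) y

/-- Differentiate the invariance relation in time. The point `t = 1` is used because it is interior
to the half-line where invariance is assumed. -/
theorem IsInvariantDistribution.vecMul_eq_zero {Q : Matrix S S ℝ} {π : S → ℝ}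
    (h : IsInvariantDistribution Q π) : Matrix.vecMul π Q = 0 := by
  ext y
  have h1 : HasDerivAt (fun u => ∑ x, π x * transitionMatrix Q u x y)
      (∑ x, π x * (transitionMatrix Q 1 * Q) x y) 1 :=
    HasDerivAt.fun_sum fun x _ => (hasDerivAt_transitionMatrix Q 1 x y).const_mul _
  have h2 : (fun u => ∑ x, π x * transitionMatrix Q u x y) =ᶠ[nhds 1] fun _ => π y := by
    filter_upwards [Ioi_mem_nhds (zero_lt_one (α := ℝ))] with u hu
    exact congrFun (h.invariant u (le_of_lt hu)) y
  have h3 := h1.unique ((hasDerivAt_const (1 : ℝ) (π y)).congr_of_eventuallyEq h2)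
  have h4 : Matrix.vecMul π (transitionMatrix Q 1 * Q) y = 0 := h3
  rwa [← Matrix.vecMul_vecMul, h.invariant 1 zero_le_one] at h4

variable {Q : Matrix S S ℝ}

/-- The triangle inequality in the balance equation at `y` makes each component of `|v| Q`
nonnegative; zero row sums make the components add up to zero. -/
theorem abs_vecMul_eq_zero (hQ : ∀ x y, x ≠ y → 0 ≤ Q x y) (hrow : ∀ x, ∑ y, Q x y = 0)
    {v : S → ℝ} (hv : Matrix.vecMul v Q = 0) : Matrix.vecMul (fun x => |v x|) Q = 0 := by
  have hnonneg : ∀ y, 0 ≤ Matrix.vecMul (fun x => |v x|) Q y := by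
    intro y
    have hdiag : Q y y ≤ 0 := by
      have := hrow y
      rw [← Finset.add_sum_erase _ _ (Finset.mem_univ y)] at this
      have h2 : 0 ≤ ∑ z ∈ Finset.univ.erase y, Q y z :=
        Finset.sum_nonneg fun z hz => hQ _ _ (Finset.ne_of_mem_erase hz).symm
      linarith
    have h1 : ∑ x, v x * Q x y = 0 := congrFun hv y
    change 0 ≤ ∑ x, |v x| * Q x y
    rw [← Finset.add_sum_erase _ _ (Finset.mem_univ y)] at h1 ⊢
    have h2 : |∑ x ∈ Finset.univ.erase y, v x * Q x y| ≤
        ∑ x ∈ Finset.univ.erase y, |v x| * Q x y := by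
      refine (Finset.abs_sum_le_sum_abs _ _).trans (le_of_eq (Finset.sum_congr rfl fun x hx => ?_))
      rw [abs_mul, abs_of_nonneg (hQ _ _ (Finset.ne_of_mem_erase hx))]
    have h3 : ∑ x ∈ Finset.univ.erase y, v x * Q x y = -(v y * Q y y) := by linarith
    rw [h3, abs_neg, abs_mul, abs_of_nonpos hdiag] at h2
    linarith
  have hsum : ∑ y, Matrix.vecMul (fun x => |v x|) Q y = 0 := by
    change ∑ y, ∑ x, |v x| * Q x y = 0
    rw [Finset.sum_comm]
    simp_rw [← Finset.mul_sum, hrow]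
    simp
  ext y
  exact (Finset.sum_eq_zero_iff_of_nonneg fun y _ => hnonneg y).1 hsum y (Finset.mem_univ y)

/-- `Q` kills constants, hence is singular and has a nonzero left null vector; its absolute value,
normalized, is stationary too. -/
theorem exists_stationary_vector [Nonempty S] (hQ : ∀ x y, x ≠ y → 0 ≤ Q x y)
    (hrow : ∀ x, ∑ y, Q x y = 0) :
    ∃ π : S → ℝ, (∀ x, 0 ≤ π x) ∧ ∑ x, π x = 1 ∧ Matrix.vecMul π Q = 0 := by
  have hdet : Q.det = 0 := by
    refine Matrix.exists_mulVec_eq_zero_iff.1 ⟨fun _ => 1, ?_, ?_⟩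
    · obtain ⟨x⟩ := ‹Nonempty S›
      exact fun h => one_ne_zero (congrFun h x)
    · ext x
      simpa [Matrix.mulVec, dotProduct] using hrow x
  obtain ⟨v, hv0, hv⟩ := Matrix.exists_vecMul_eq_zero_iff.2 hdet
  have habs := abs_vecMul_eq_zero hQ hrow hv
  have hpos : 0 < ∑ x, |v x| := by
    obtain ⟨x, hx⟩ := Function.ne_iff.1 hv0
    exact Finset.sum_pos' (fun x _ => abs_nonneg _) ⟨x, Finset.mem_univ x, abs_pos.2 hx⟩
  refine ⟨(∑ x, |v x|)⁻¹ • fun x => |v x|, fun x => ?_, ?_, ?_⟩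
  · exact mul_nonneg (inv_nonneg.2 hpos.le) (abs_nonneg _)
  · simp only [Pi.smul_apply, smul_eq_mul, ← Finset.mul_sum]
    exact inv_mul_cancel₀ hpos.ne'
  · rw [Matrix.smul_vecMul, habs, smul_zero]

/-- A nonnegative stationary vector vanishing at the bottom state vanishes everywhere. -/
theorem eq_zero_of_vecMul_eq_zero (hQ : ∀ x y, x ≠ y → 0 ≤ Q x y) (h : S → ℕ) (b : S)
    (hdown : ∀ x, x ≠ b → ∃ y, h y < h x ∧ 0 < Q x y) {v : S → ℝ} (hv0 : ∀ x, 0 ≤ v x)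
    (hv : Matrix.vecMul v Q = 0) (hb : v b = 0) (x : S) : v x = 0 := by
  induction hn : h x using Nat.strong_induction_on generalizing x with
  | _ n ih =>
    subst hn
    by_cases hx : x = b
    · rwa [hx]
    obtain ⟨y, hy, hxy⟩ := hdown x hx
    have hvy := ih _ hy y rfl
    -- As `v y = 0`, balance at `y` is a vanishing sum of nonnegative inflows, one of which comes
    -- from `x` at positive rate.
    have h1 : ∑ z, v z * Q z y = 0 := congrFun hv y
    have h2 : ∀ z ∈ Finset.univ, 0 ≤ v z * Q z y := by
      intro z _
      by_cases hz : z = y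
      · rw [hz, hvy, zero_mul]
      · exact mul_nonneg (hv0 z) (hQ _ _ hz)
    have h3 := (Finset.sum_eq_zero_iff_of_nonneg h2).1 h1 x (Finset.mem_univ x)
    exact (mul_eq_zero.1 h3).resolve_right hxy.ne'

/-- Uniqueness of the invariant distribution when the state `b` can be reached from all states. -/
theorem IsInvariantDistribution.isUnique (hQ : ∀ x y, x ≠ y → 0 ≤ Q x y)
    (hrow : ∀ x, ∑ y, Q x y = 0) (h : S → ℕ) (b : S)
    (hdown : ∀ x, x ≠ b → ∃ y, h y < h x ∧ 0 < Q x y) {π : S → ℝ}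
    (hπ : IsInvariantDistribution Q π) : IsUniqueInvariantDistribution Q π := by
  have key : ∀ π π' : S → ℝ, IsInvariantDistribution Q π → IsInvariantDistribution Q π' →
      π b ≤ π' b → π = π' := by
    intro π π' hπ hπ' hb
    have hd : Matrix.vecMul (π - π') Q = 0 := by
      rw [Matrix.sub_vecMul, hπ.vecMul_eq_zero, hπ'.vecMul_eq_zero, sub_zero]
    -- Twice the positive part of the difference is stationary and vanishes at `b`, hence
    -- everywhere; so `π ≤ π'`, and equal masses force equality.
    have hp : Matrix.vecMul ((fun x => |(π - π') x|) + (π - π')) Q = 0 := by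
      rw [Matrix.add_vecMul, abs_vecMul_eq_zero hQ hrow hd, hd, add_zero]
    have h0 := eq_zero_of_vecMul_eq_zero hQ h b hdown
      (fun x => by
        have := neg_abs_le ((π - π') x)
        simp only [Pi.add_apply]; linarith) hp
      (by
        have : (π - π') b ≤ 0 := sub_nonpos.2 hb
        simp only [Pi.add_apply, abs_of_nonpos this]; ring)
    have hle : ∀ x ∈ Finset.univ, π x ≤ π' x := by
      intro x _
      have h1 := h0 x
      have h2 := abs_nonneg ((π - π') x)
      simp only [Pi.add_apply, Pi.sub_apply] at h1 h2
      linarith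
    have hsum : ∑ x, π x = ∑ x, π' x := by rw [hπ.sum_eq_one, hπ'.sum_eq_one]
    ext x
    exact (Finset.sum_eq_sum_iff_of_le hle).1 hsum x (Finset.mem_univ x)
  refine ⟨hπ, fun π' hπ' => ?_⟩
  rcases le_total (π' b) (π b) with hb | hb
  · exact key _ _ hπ' hπ hb
  · exact (key _ _ hπ hπ' hb).symm

/-- Stationary weights of the jump process which applies `f · e` at rate `r e`. -/
theorem exists_stationary_weights [Nonempty S] (f : S → E → S) {r : E → ℝ} (hr : ∀ e, 0 ≤ r e) :
    ∃ μ : S → ℝ, (∀ x, 0 ≤ μ x) ∧ ∑ x, μ x = 1 ∧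
      ∀ φ : S → ℝ, ∑ x, μ x * ∑ e, r e * (φ (f x e) - φ x) = 0 := by
  obtain ⟨μ, h0, h1, h2⟩ := exists_stationary_vector
    (Q := Matrix.of fun x y : S => ∑ e, r e * ((if f x e = y then 1 else 0) -
      (if x = y then 1 else 0)))
    (fun x y hxy => by
      simp only [Matrix.of_apply, if_neg hxy, sub_zero]
      exact Finset.sum_nonneg fun e _ => mul_nonneg (hr e) (by split_ifs <;> norm_num))
    (fun x => by
      simp only [Matrix.of_apply]
      rw [Finset.sum_comm]
      refine Finset.sum_eq_zero fun e _ => ?_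
      rw [← Finset.mul_sum, Finset.sum_sub_distrib]
      simp)
  refine ⟨μ, h0, h1, fun φ => ?_⟩
  have h3 : ∀ x, ∑ e, r e * (φ (f x e) - φ x) = ∑ y, (∑ e, r e * ((if f x e = y then 1 else 0) -
      (if x = y then 1 else 0))) * φ y := by
    intro x
    simp_rw [Finset.sum_mul]
    rw [Finset.sum_comm]
    refine Finset.sum_congr rfl fun e _ => ?_
    simp_rw [mul_assoc, ← Finset.mul_sum, sub_mul, Finset.sum_sub_distrib, ite_mul, one_mul,
      zero_mul]
    simp
  simp_rw [h3, Finset.mul_sum]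
  rw [Finset.sum_comm]
  refine Finset.sum_eq_zero fun y _ => ?_
  simp_rw [← mul_assoc, ← Finset.sum_mul]
  have h4 := congrFun h2 y
  simp only [Matrix.vecMul, dotProduct, Matrix.of_apply, Pi.zero_apply] at h4
  rw [h4, zero_mul]

omit [DecidableEq S] in
/-- The image under `g` of stationary weights is an invariant distribution of the image process. -/
theorem isInvariantDistribution_image {f : S → E → S} {r : E → ℝ} {μ : S → ℝ}
    (h0 : ∀ x, 0 ≤ μ x) (h1 : ∑ x, μ x = 1)
    (h2 : ∀ φ : S → ℝ, ∑ x, μ x * ∑ e, r e * (φ (f x e) - φ x) = 0)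
    {g : S → S'} {Q : Matrix S' S' ℝ}
    (hQ : ∀ x y, ∑ e, r e * ((if g (f x e) = y then 1 else 0) - (if g x = y then 1 else 0)) =
      Q (g x) y) :
    IsInvariantDistribution Q (fun y => ∑ x, if g x = y then μ x else 0) where
  nonneg y := Finset.sum_nonneg fun x _ => by split_ifs <;> simp [h0]
  sum_eq_one := by
    rw [Finset.sum_comm]
    simpa using h1
  invariant t _ := by
    refine vecMul_transitionMatrix ?_ t
    ext y
    change ∑ z, (∑ x, if g x = z then μ x else 0) * Q z y = 0
    simp_rw [Finset.sum_mul, ite_mul, zero_mul]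
    rw [Finset.sum_comm]
    -- Lumping amounts to testing stationarity against the indicator of a fibre of `g`.
    simpa [← hQ] using h2 fun x => if g x = y then 1 else 0

end Stationary

/-! ### Comparing event rates with a generator -/

section Generator

variable {S S' E : Type*} [Fintype S'] [DecidableEq S'] [Fintype E]

theorem jumpGenerator_apply_of_ne (q : S' → S' → ℝ) {x y : S'} (h : x ≠ y) :
    jumpGenerator q x y = q x y := by
  simp [jumpGenerator, h]

theorem sum_jumpGenerator (q : S' → S' → ℝ) (x : S') : ∑ y, jumpGenerator q x y = 0 := by
  simp [jumpGenerator, Matrix.diagonal_apply, Finset.sum_sub_distrib]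

/-- The rates of the image under `g` need to be compared off the diagonal only. -/
theorem sum_rates_eq_jumpGenerator {f : S → E → S} {g : S → S'} {r : E → ℝ} {q : S' → S' → ℝ}
    (h : ∀ x y, g x ≠ y → ∑ e, r e * (if g (f x e) = y then 1 else 0) = q (g x) y) (x : S)
    (y : S') :
    ∑ e, r e * ((if g (f x e) = y then 1 else 0) - (if g x = y then 1 else 0)) =
      jumpGenerator q (g x) y := by
  have hne : ∀ y, g x ≠ y → ∑ e, r e * ((if g (f x e) = y then 1 else 0) -
      (if g x = y then 1 else 0)) = jumpGenerator q (g x) y := by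
    intro y hy
    rw [jumpGenerator_apply_of_ne q hy, ← h x y hy]
    simp [hy]
  by_cases hy : g x = y
  · have h1 : ∑ y, ∑ e, r e * ((if g (f x e) = y then 1 else 0) -
        (if g x = y then 1 else 0)) = (0 : ℝ) := by
      rw [Finset.sum_comm]
      refine Finset.sum_eq_zero fun e _ => ?_
      rw [← Finset.mul_sum, Finset.sum_sub_distrib]
      simp
    have h2 := sum_jumpGenerator q (g x)
    rw [← Finset.add_sum_erase _ _ (Finset.mem_univ y)] at h1 h2
    rw [Finset.sum_congr rfl fun z hz => hne z (hy ▸ (Finset.ne_of_mem_erase hz).symm)] at h1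
    linarith
  · exact hne y hy

end Generator

/-! ### The queues and their coupling -/

section Queues

theorem mmcGenerator_unique {c m : ℕ} {a s : ℝ} (hc : 1 ≤ c) (ha : 0 < a) (hs : 0 < s)
    {π : Fin (m + 1) → ℝ} (hπ : IsInvariantDistribution (mmcGenerator c m a s) π) :
    IsUniqueInvariantDistribution (mmcGenerator c m a s) π := by
  unfold mmcGenerator at *
  refine hπ.isUnique (fun x y hxy => ?_) (sum_jumpGenerator _) (fun x : Fin (m + 1) => (x : ℕ)) 0
    (fun x hx => ?_)
  · rw [jumpGenerator_apply_of_ne _ hxy, mmcRate]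
    split_ifs <;> positivity
  · have hx' : 1 ≤ (x : ℕ) := Nat.one_le_iff_ne_zero.2 fun h => hx (Fin.ext h)
    refine ⟨⟨x - 1, by omega⟩, by simp only; omega, ?_⟩
    rw [jumpGenerator_apply_of_ne _ (by simp only [ne_eq, Fin.ext_iff]; omega),
      mmcRate, if_neg (by simp only; omega), if_pos (by simp only; omega)]
    have : 0 < min (x : ℕ) c := by omega
    positivity

theorem jsqRate_nonneg {K : ℕ} {ρ : ℝ} (hρ : 0 < ρ) (x y : JSQState K) : 0 ≤ jsqRate K ρ x y := by
  unfold jsqRate joinRate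
  split_ifs <;> positivity

theorem jsqGenerator_unique {K : ℕ} {ρ : ℝ} (hρ : 0 < ρ) {π : JSQState K → ℝ}
    (hπ : IsInvariantDistribution (jsqGenerator K ρ) π) :
    IsUniqueInvariantDistribution (jsqGenerator K ρ) π := by
  unfold jsqGenerator at *
  refine hπ.isUnique (fun x y hxy => ?_) (sum_jumpGenerator _) (fun x => (x.1 : ℕ) + x.2) (0, 0)
    (fun x hx => ?_)
  · rw [jumpGenerator_apply_of_ne _ hxy]
    exact jsqRate_nonneg hρ x y
  · by_cases h1 : (x.1 : ℕ) = 0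
    · have h2 : 1 ≤ (x.2 : ℕ) := Nat.one_le_iff_ne_zero.2 fun h =>
        hx (Prod.ext (Fin.ext h1) (Fin.ext h))
      refine ⟨(x.1, ⟨x.2 - 1, by omega⟩), by simp only; omega, ?_⟩
      rw [jumpGenerator_apply_of_ne _
        (by simp only [ne_eq, Prod.ext_iff, Fin.ext_iff]; omega), jsqRate,
        if_neg (by simp only [Fin.ext_iff]; omega), if_neg (by simp only; omega),
        if_neg (by simp only [Fin.ext_iff]; omega), if_pos (by simp only [true_and]; omega)]
      norm_num
    · refine ⟨(⟨x.1 - 1, by omega⟩, x.2), by simp only; omega, ?_⟩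
      rw [jumpGenerator_apply_of_ne _
        (by simp only [ne_eq, Prod.ext_iff, Fin.ext_iff]; omega), jsqRate,
        if_neg (by simp only; omega), if_neg (by simp only [Fin.ext_iff]; omega),
        if_pos (by simp only [and_true]; omega)]
      norm_num

/-- One more customer, unless the system is full. -/
def arrive {n : ℕ} (x : Fin (n + 1)) : Fin (n + 1) := ⟨min (x + 1) n, by omega⟩

/-- One customer fewer, unless the system is empty. -/
def depart {n : ℕ} (x : Fin (n + 1)) : Fin (n + 1) := ⟨x - 1, by omega⟩

/-- A lost arrival leaves the state unchanged, so the truncation at `n` is invisible off the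
diagonal. -/
theorem arrive_eq_iff {n : ℕ} {x y : Fin (n + 1)} (h : x ≠ y) :
    arrive x = y ↔ (y : ℕ) = x + 1 := by
  simp only [arrive, Fin.ext_iff, ne_eq] at *
  omega

theorem depart_eq_iff {n : ℕ} {x y : Fin (n + 1)} (h : x ≠ y) :
    depart x = y ↔ (x : ℕ) = y + 1 := by
  simp only [depart, Fin.ext_iff, ne_eq] at *
  omega

/-- An arriving customer joins the shorter queue; ties are broken by `coin`. -/
def jsqArrive {K : ℕ} (x : JSQState K) (coin : Bool) : JSQState K :=
  if (x.1 : ℕ) < x.2 ∨ (x.1 : ℕ) = x.2 ∧ coin = true then (arrive x.1, x.2)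
  else (x.1, arrive x.2)

/-- End of a service at the first server (if `first` is true) or the second one. -/
def jsqDepart {K : ℕ} (x : JSQState K) (first : Bool) : JSQState K :=
  if first = true then (depart x.1, x.2) else (x.1, depart x.2)

/-- The joint states of the `M/M/1/2K`, `M/M/2/2K`, join-the-shortest-queue and `M/M/1/K`
systems. -/
abbrev CoupledState (K : ℕ) : Type := Fin (2 * K + 1) × Fin (2 * K + 1) × JSQState K × Fin (K + 1)

/-- The effect of an arrival (`e.1` true) or of the end of a service on the coupled systems. A
service at the server `e.2` is effective in the `M/M/2/2K` queue with one customer if that server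
is the first busy one of the join-the-shortest-queue system. -/
def coupledStep {K : ℕ} (s : CoupledState K) (e : Bool × Bool) : CoupledState K :=
  if e.1 = true then (arrive s.1, arrive s.2.1, jsqArrive s.2.2.1 e.2, arrive s.2.2.2)
  else (depart s.1,
    if 2 ≤ (s.2.1 : ℕ) ∨ (e.2 = true ↔ 0 < (s.2.2.1.1 : ℕ)) then depart s.2.1 else s.2.1,
    jsqDepart s.2.2.1 e.2, depart s.2.2.2)

/-- The rates of the arrivals and of the services in `coupledStep`. -/
def eventRate (ρ : ℝ) (e : Bool × Bool) : ℝ := if e.1 = true then ρ else 1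

theorem eventRate_nonneg {ρ : ℝ} (hρ : 0 < ρ) (e : Bool × Bool) : 0 ≤ eventRate ρ e := by
  unfold eventRate
  split_ifs <;> positivity

theorem sum_eventRate_pos {ρ : ℝ} (hρ : 0 < ρ) : 0 < ∑ e, eventRate ρ e := by
  simp only [Fintype.sum_prod_type, Fintype.sum_bool, eventRate]
  norm_num
  positivity

/-- If JSQ alone loses an arrival, it holds `2 * K` customers, the capacity of the queues below it.
If a service removes a JSQ customer but not the only `M/M/2` customer, the first busy server is
another one, so JSQ keeps a customer. If a service is wasted in JSQ, one queue is empty and the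
total is at most `K`. -/
theorem coupledStep_queueOrder {K : ℕ} (s : CoupledState K) (e : Bool × Bool)
    (h : QueueOrder K s.1 s.2.1 s.2.2.1 s.2.2.2) :
    QueueOrder K (coupledStep s e).1 (coupledStep s e).2.1 (coupledStep s e).2.2.1
      (coupledStep s e).2.2.2 := by
  obtain ⟨⟨a, ha⟩, ⟨b, hb⟩, ⟨⟨l, hl⟩, ⟨l', hl'⟩⟩, ⟨c, hc⟩⟩ := s
  obtain ⟨arrival, i⟩ := e
  simp only [QueueOrder] at h
  cases arrival <;> cases i <;>
    simp only [QueueOrder, coupledStep, jsqArrive, jsqDepart, arrive, depart, if_true, if_false,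
      Bool.false_eq_true, and_false, or_false, and_true, true_iff, false_iff] <;>
    split_ifs <;> simp only <;> omega

theorem sum_rates_single {K : ℕ} {ρ : ℝ} {n : ℕ} (g : CoupledState K → Fin (n + 1))
    (hg : ∀ s e, g (coupledStep s e) = if e.1 = true then arrive (g s) else depart (g s))
    (s : CoupledState K) (y : Fin (n + 1)) :
    ∑ e, eventRate ρ e * ((if g (coupledStep s e) = y then 1 else 0) -
      (if g s = y then 1 else 0)) = mmcGenerator 1 n (2 * ρ) 2 (g s) y := by
  refine sum_rates_eq_jumpGenerator (fun s y hsy => ?_) s y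
  simp only [hg, Fintype.sum_prod_type, Fintype.sum_bool, eventRate, if_true, Bool.false_eq_true,
    if_false, arrive_eq_iff hsy, depart_eq_iff hsy, mmcRate]
  by_cases h1 : (y : ℕ) = g s + 1
  · rw [if_pos h1, if_neg (by omega), if_pos h1]
    ring
  · rw [if_neg h1, if_neg h1]
    by_cases h2 : (g s : ℕ) = y + 1
    · rw [if_pos h2, if_pos h2, min_eq_right (by omega)]
      norm_num
    · rw [if_neg h2, if_neg h2]
      norm_num

/-- With one customer, exactly one of the two service marks is effective, whatever the JSQ state, so
the departure rate is 1 and the coordinate is autonomous. -/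
theorem sum_rates_double {K : ℕ} {ρ : ℝ} (s : CoupledState K) (y : Fin (2 * K + 1)) :
    ∑ e, eventRate ρ e * ((if (coupledStep s e).2.1 = y then 1 else 0) -
      (if s.2.1 = y then 1 else 0)) = mmcGenerator 2 (2 * K) (2 * ρ) 1 s.2.1 y := by
  refine sum_rates_eq_jumpGenerator (g := fun s : CoupledState K => s.2.1) (fun s y hsy => ?_) s y
  simp only [Fintype.sum_prod_type, Fintype.sum_bool, eventRate, if_true, Bool.false_eq_true,
    if_false, coupledStep, arrive_eq_iff hsy, mmcRate, true_iff, false_iff, ite_eq_iff', hsy,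
    depart_eq_iff hsy, imp_false, not_not]
  by_cases h1 : (y : ℕ) = s.2.1 + 1
  · have h2 : ¬ (s.2.1 : ℕ) = y + 1 := by omega
    rw [if_pos h1, if_pos h1, if_neg (by tauto), if_neg (by tauto)]
    ring
  · rw [if_neg h1, if_neg h1]
    by_cases h2 : (s.2.1 : ℕ) = y + 1
    · rw [if_pos h2]
      by_cases h3 : 2 ≤ (s.2.1 : ℕ)
      · rw [if_pos (by tauto), if_pos (by tauto), min_eq_right h3]
        norm_num
      · rw [min_eq_left (by omega), show (s.2.1 : ℕ) = 1 by omega]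
        by_cases h4 : 0 < (s.2.2.1.1 : ℕ)
        · simp [h4, show (y : ℕ) = 0 by omega]
        · simp [h4, show (y : ℕ) = 0 by omega]
    · rw [if_neg h2, if_neg (by tauto), if_neg (by tauto)]
      norm_num

theorem sum_rates_jsq {K : ℕ} {ρ : ℝ} (s : CoupledState K) (y : JSQState K) :
    ∑ e, eventRate ρ e * ((if (coupledStep s e).2.2.1 = y then 1 else 0) -
      (if s.2.2.1 = y then 1 else 0)) = jsqGenerator K ρ s.2.2.1 y := by
  refine sum_rates_eq_jumpGenerator (g := fun s : CoupledState K => s.2.2.1)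
    (fun s y hsy => ?_) s y
  simp only [Fintype.sum_prod_type, Fintype.sum_bool, eventRate, if_true, Bool.false_eq_true,
    if_false, coupledStep, jsqDepart, jsqArrive, and_true, and_false, or_false]
  generalize s.2.2.1 = x at *
  obtain ⟨⟨a, ha⟩, ⟨b, hb⟩⟩ := x
  obtain ⟨⟨a', ha'⟩, ⟨b', hb'⟩⟩ := y
  simp only [jsqRate, joinRate, arrive, depart, Prod.mk.injEq, Fin.mk.injEq, ne_eq] at *
  -- The target differs from the source, which rules out lost arrivals and services in empty queues.
  have e1 : (min (a + 1) K = a' ∧ b = b') ↔ (a' = a + 1 ∧ b' = b) := by omega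
  have e2 : (a = a' ∧ min (b + 1) K = b') ↔ (a' = a ∧ b' = b + 1) := by omega
  have e3 : (a - 1 = a' ∧ b = b') ↔ (a = a' + 1 ∧ b' = b) := by omega
  have e4 : (a = a' ∧ b - 1 = b') ↔ (a' = a ∧ b = b' + 1) := by omega
  have h1 : (if a < b ∨ a = b then ((⟨min (a + 1) K, by omega⟩ : Fin (K + 1)),
      (⟨b, hb⟩ : Fin (K + 1))) else (⟨a, ha⟩, ⟨min (b + 1) K, by omega⟩)) = (⟨a', ha'⟩, ⟨b', hb'⟩) ↔
      if a < b ∨ a = b then (a' = a + 1 ∧ b' = b) else (a' = a ∧ b' = b + 1) := by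
    split_ifs <;> simp only [Prod.mk.injEq, Fin.mk.injEq, e1, e2]
  have h2 : (if a < b then ((⟨min (a + 1) K, by omega⟩ : Fin (K + 1)),
      (⟨b, hb⟩ : Fin (K + 1))) else (⟨a, ha⟩, ⟨min (b + 1) K, by omega⟩)) = (⟨a', ha'⟩, ⟨b', hb'⟩) ↔
      if a < b then (a' = a + 1 ∧ b' = b) else (a' = a ∧ b' = b + 1) := by
    split_ifs <;> simp only [Prod.mk.injEq, Fin.mk.injEq, e1, e2]
  simp only [h1, h2, e3, e4]
  clear h1 h2 e1 e2 e3 e4 hsy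
  rcases lt_trichotomy a b with hab | hab | hab
  · simp only [hab, true_or, if_true]
    split_ifs <;> first | omega | ring
  · simp only [hab, lt_irrefl, or_true, if_true, if_false]
    split_ifs <;> first | omega | ring
  · simp only [hab, hab.not_gt, hab.ne', hab.ne, or_false, if_true, if_false]
    split_ifs <;> first | omega | ring

end Queues

/-! ### Assembly of the coupling and of the blocking inequalities -/

theorem mainTheorem6 (K : ℕ) (hK : 1 ≤ K) (ρ : ℝ) (hρ : 0 < ρ) :
    -- the coupling, for every joint law `μ` of the four initial states
    (∀ μ : PMF (Fin (2 * K + 1) × Fin (2 * K + 1) × JSQState K × Fin (K + 1)),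
      ∃ (Ω : Type) (_ : MeasurableSpace Ω) (P : MeasureTheory.Measure Ω)
        (Nlow : ℝ≥0 → Ω → Fin (2 * K + 1)) (Nmid : ℝ≥0 → Ω → Fin (2 * K + 1))
        (L : ℝ≥0 → Ω → JSQState K) (Nup : ℝ≥0 → Ω → Fin (K + 1)),
        MeasureTheory.IsProbabilityMeasure P ∧
        IsMarkovJumpProcess (mmcGenerator 1 (2 * K) (2 * ρ) 2) P Nlow ∧
        IsMarkovJumpProcess (mmcGenerator 2 (2 * K) (2 * ρ) 1) P Nmid ∧
        IsMarkovJumpProcess (jsqGenerator K ρ) P L ∧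
        IsMarkovJumpProcess (mmcGenerator 1 K (2 * ρ) 2) P Nup ∧
        (∀ s, P {ω | (Nlow 0 ω, Nmid 0 ω, L 0 ω, Nup 0 ω) = s} = μ s) ∧
        ∀ᵐ ω ∂P, QueueOrder K (Nlow 0 ω) (Nmid 0 ω) (L 0 ω) (Nup 0 ω) →
          ∀ t : ℝ≥0, QueueOrder K (Nlow t ω) (Nmid t ω) (L t ω) (Nup t ω)) ∧
    -- the comparison of the stationary blocking probabilities
    (∃ (νlow νmid : Fin (2 * K + 1) → ℝ) (π : JSQState K → ℝ) (νup : Fin (K + 1) → ℝ),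
      IsUniqueInvariantDistribution (mmcGenerator 1 (2 * K) (2 * ρ) 2) νlow ∧
      IsUniqueInvariantDistribution (mmcGenerator 2 (2 * K) (2 * ρ) 1) νmid ∧
      IsUniqueInvariantDistribution (jsqGenerator K ρ) π ∧
      IsUniqueInvariantDistribution (mmcGenerator 1 K (2 * ρ) 2) νup ∧
      νlow (Fin.last (2 * K)) ≤ νmid (Fin.last (2 * K)) ∧
      νmid (Fin.last (2 * K)) ≤ π (Fin.last K, Fin.last K) ∧
      π (Fin.last K, Fin.last K) ≤ νup (Fin.last K)) := by
  have hr := eventRate_nonneg hρ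
  have hsum := sum_eventRate_pos hρ
  have hlow : ∀ s e, (coupledStep (K := K) s e).1 =
      if e.1 = true then arrive s.1 else depart s.1 := fun s e => by
    unfold coupledStep; split_ifs <;> rfl
  have hup : ∀ s e, (coupledStep (K := K) s e).2.2.2 =
      if e.1 = true then arrive s.2.2.2 else depart s.2.2.2 := fun s e => by
    unfold coupledStep; split_ifs <;> rfl
  refine ⟨fun μ => ?_, ?_⟩
  · have := isProbabilityMeasure_jumpMeasure hsum (markLaw (eventRate ρ) hr hsum)
    refine ⟨CoupledState K × (ℕ → ℝ × (Bool × Bool)), inferInstance,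
      μ.toMeasure.prod (jumpMeasure (∑ e, eventRate ρ e) (markLaw (eventRate ρ) hr hsum)),
      fun t ω => (jumpProcess coupledStep t ω).1, fun t ω => (jumpProcess coupledStep t ω).2.1,
      fun t ω => (jumpProcess coupledStep t ω).2.2.1,
      fun t ω => (jumpProcess coupledStep t ω).2.2.2, inferInstance, ?_, ?_, ?_, ?_, ?_, ?_⟩
    · exact isMarkovJumpProcess_of_rates (g := fun s : CoupledState K => s.1) hr hsum μ
        (fun y => ⟨(y, 0, 0, 0), rfl⟩) (sum_rates_single (fun s : CoupledState K => s.1) hlow)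
    · exact isMarkovJumpProcess_of_rates (g := fun s : CoupledState K => s.2.1) hr hsum μ
        (fun y => ⟨(0, y, 0, 0), rfl⟩) sum_rates_double
    · exact isMarkovJumpProcess_of_rates (g := fun s : CoupledState K => s.2.2.1) hr hsum μ
        (fun y => ⟨(0, 0, y, 0), rfl⟩) sum_rates_jsq
    · exact isMarkovJumpProcess_of_rates (g := fun s : CoupledState K => s.2.2.2) hr hsum μ
        (fun y => ⟨(0, 0, 0, y), rfl⟩) (sum_rates_single (fun s : CoupledState K => s.2.2.2) hup)
    · exact fun s => measure_jumpProcess_zero hsum μ s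
    · exact Eventually.of_forall fun ω h t => jumpProcess_mem_of_le
        (T := {s : CoupledState K | QueueOrder K s.1 s.2.1 s.2.2.1 s.2.2.2})
        (fun s hs e => coupledStep_queueOrder s e hs) (zero_le : 0 ≤ t) h
  -- The chain is restricted to ordered states, so its stationary weights are carried by them
  -- without any limit in time.
  · let T := {s : CoupledState K // QueueOrder K s.1 s.2.1 s.2.2.1 s.2.2.2}
    have hT : Nonempty T := ⟨⟨(0, 0, 0, 0), by simp [QueueOrder]⟩⟩
    classical
    obtain ⟨μ, h0, h1, h2⟩ := exists_stationary_weights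
      (fun (s : T) e => (⟨coupledStep s.1 e, coupledStep_queueOrder s.1 e s.2⟩ : T)) hr
    refine ⟨_, _, _, _,
      mmcGenerator_unique le_rfl (by positivity) two_pos (isInvariantDistribution_image
        (g := fun s : T => s.1.1) h0 h1 h2 fun s y =>
          sum_rates_single (fun s : CoupledState K => s.1) hlow s.1 y),
      mmcGenerator_unique one_le_two (by positivity) one_pos (isInvariantDistribution_image
        (g := fun s : T => s.1.2.1) h0 h1 h2 fun s y => sum_rates_double s.1 y),
      jsqGenerator_unique hρ (isInvariantDistribution_image
        (g := fun s : T => s.1.2.2.1) h0 h1 h2 fun s y => sum_rates_jsq s.1 y),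
      mmcGenerator_unique le_rfl (by positivity) two_pos (isInvariantDistribution_image
        (g := fun s : T => s.1.2.2.2) h0 h1 h2 fun s y =>
          sum_rates_single (fun s : CoupledState K => s.2.2.2) hup s.1 y),
      ?_, ?_, ?_⟩
    -- Term by term: in an ordered state, `a = 2 * K` forces `b = 2 * K`, which forces `l = l' = K`,
    -- which forces `c = K`.
    all_goals
      refine Finset.sum_le_sum fun s _ => ?_
      obtain ⟨⟨a, b, ⟨l, l'⟩, c⟩, hs⟩ := s
      obtain ⟨hab, hbl, hlc⟩ : (a : ℕ) ≤ b ∧ (b : ℕ) ≤ l + l' ∧ (l : ℕ) + l' ≤ K + c := hs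
      simp only [Fin.ext_iff, Fin.val_last, Prod.mk.injEq] at *
      split_ifs
      all_goals first | exact le_rfl | exact h0 _ | (exfalso; omega)
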